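/- Let $G$ be a finite connected plane directed multigraph; every edge carries two opposite darts, with capacities $c\ge 0$ on the darts. Let $s_1,t_1,s_2,t_2,\dots,s_m,t_m$ be distinct vertices (sources $s_i$ and sinks $t_j$) that occur in this clockwise order on the boundary $\partial G$ of the infinite face $f_\infty$ (each terminal is given with a position on the boundary walk). For capacities $c$ and a flow $f$ (a real function on darts that is antisymmetric under reversal, satisfies $f\le c$, and is balanced at non-terminals), the residual capacities are $c-f$; a path or cycle is residual if all its darts have positive residual capacity. A maximum $xy$-flow is leftmost if after it no clockwise (simple) cycle is residual. Consider the following procedure. First, by pushing some flow, saturate all residual $s_j$-to-$t_i$ paths with $i<j$ and all clockwise cycles, i.e. pass to residual capacities $c_0$ with respect to which none of these is residual. Then, for $j=1,\dots,m$ and, within this, for $i=j,j-1,\dots,1$ (iteration $(i,j)$), let $c'_{ij}$ be the current residual capacities, let $f_{ij}$ be the leftmost maximum $s_i$-to-$t_j$ flow with respect to $c'_{ij}$, of value $|f_{ij}|$, and let $c_{ij}=c'_{ij}-f_{ij}$ be the new residual capacities. For a dart $d$ let the dual dart $d^*$ lead from the face left of $d$ to the face right of $d$, and let its length be $c'_{ij}[d]$.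 Let $G^*_{s_it_j}$ be the dual graph with $f_\infty^*$ split into two vertices $a_\infty^*$ and $b_\infty^*$, such that the duals of the edges of the clockwise boundary part $\partial G[s_i,t_j]$ are incident to $a_\infty^*$ and those of $\partial G[t_j,s_i]$ to $b_\infty^*$. Let $C^*$ be the leftmost one among the simple shortest $a_\infty^*$-to-$b_\infty^*$ paths in $G^*_{s_it_j}$, so that $C$ is the leftmost minimum $s_it_j$-cut. Here a dual path is (weakly) left of $C^*$ if it is contained in the closed region on the $t_j$-side of $C^*$, i.e. each of its edges is an edge of $C^*$ or the dual of an edge with both ends on the $t_j$-side of $C$; and $C^*$ is leftmost if no other simple shortest $a_\infty^*$-to-$b_\infty^*$ path is left of it. Then for every iteration $(i,j)$ and every path $W^*$ in $G^*_{s_it_j}$ (possibly with repeated vertices, not necessarily a shortest path) that starts at $a_\infty^*$, has length exactly $|f_{ij}|$ and is left of $C^*$: no simple path from a source $s_k$ to a sink $t_\ell$ (any $k,\ell$) that is residual with respect to $c_{ij}$ uses a dart of $W=\{d : d^*\in W^*\}$. -/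

import Mathlib

/-!
Plane graphs are given by rotation systems. Every edge carries two opposite darts `d` and `rev d`;
`rot d` is the next dart with the same tail as `d`, in counterclockwise order. The face to the left
of `d` is traversed by `d ↦ rot⁻¹ (rev d)`, keeping the face on the left. For the infinite
face this traversal is the clockwise traversal of the boundary of the graph.
-/

namespace BoundaryFlow

/-- A connected plane (multi)graph with finite set of darts `D`, vertices the orbits of `rot`,
faces the orbits of `rot⁻¹ ∘ rev`; planarity is Euler's formula `|V| - |E| + |F| = 2` with
`|D| = 2 |E|`. The infinite face is the face to the left of the dart `outer`. -/
structure PlaneGraph (D : Type*) [Fintype D] where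
  rot : Equiv.Perm D
  rev : Equiv.Perm D
  rev_rev : ∀ d, rev (rev d) = d
  rev_ne : ∀ d, rev d ≠ d
  connected : ∀ d e, Relation.ReflTransGen (fun x y => y = rot x ∨ y = rev x) d e
  euler : 2 * Nat.card (Quotient (Equiv.Perm.SameCycle.setoid rot)) +
      2 * Nat.card (Quotient (Equiv.Perm.SameCycle.setoid (rot⁻¹ * rev))) = Fintype.card D + 4
  outer : D

/-- `IsWalk src tgt u W v`: the list `W` of darts is a path (possibly with repeated vertices, possibly
trivial) from `u` to `v`, where a dart `d` leads from `src d` to `tgt d`. -/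
def IsWalk {D X : Type*} (src tgt : D → X) : X → List D → X → Prop
  | u, [], v => u = v
  | u, d :: W, v => src d = u ∧ IsWalk src tgt (tgt d) W v

/-- A path that visits no vertex twice. -/
def IsSimplePath {D X : Type*} (src tgt : D → X) (u : X) (W : List D) (v : X) : Prop :=
  IsWalk src tgt u W v ∧ (u :: W.map tgt).Nodup

/-- Total length (capacity) of the darts of a path. -/
def length {D : Type*} (c : D → ℝ) (W : List D) : ℝ := (W.map c).sum

/-- All darts have strictly positive residual capacity. -/
def IsResidual {D : Type*} (c : D → ℝ) (W : List D) : Prop := ∀ d ∈ W, 0 < c d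

/-- The vertices of the split dual: the infinite face is split into `a` and `b`. -/
inductive SplitFace (F : Type*) where
  | a : SplitFace F
  | b : SplitFace F
  | inner : F → SplitFace F

namespace PlaneGraph

variable {D : Type*} [Fintype D] (G : PlaneGraph D)

/-- The next dart on the boundary walk of the face to the left. -/
def faceNext : Equiv.Perm D := G.rot⁻¹ * G.rev

abbrev Vertex : Type _ := Quotient (Equiv.Perm.SameCycle.setoid G.rot)

abbrev Face : Type _ := Quotient (Equiv.Perm.SameCycle.setoid G.faceNext)

def tail (d : D) : G.Vertex := Quotient.mk (Equiv.Perm.SameCycle.setoid G.rot) d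

def head (d : D) : G.Vertex := G.tail (G.rev d)

/-- The face to the left of a dart. -/
def left (d : D) : G.Face := Quotient.mk (Equiv.Perm.SameCycle.setoid G.faceNext) d

/-- The face to the right of a dart. The dual of `d` leads from `left d` to `right d`. -/
def right (d : D) : G.Face := G.left (G.rev d)

def infFace : G.Face := G.left G.outer

/-- A (nonempty) simple directed cycle of `G`. -/
def IsSimpleCycle (Z : List D) : Prop :=
  Z ≠ [] ∧ (∃ u, IsWalk G.tail G.head u Z u) ∧ (Z.map G.head).Nodup

/-- The faces outside `Z`: those joined to the infinite face by dual paths not crossing `Z`. -/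
def OutsideFace (Z : List D) (x : G.Face) : Prop :=
  Relation.ReflTransGen
    (fun y z => ∃ d, G.left d = y ∧ G.right d = z ∧ d ∉ Z ∧ G.rev d ∉ Z) G.infFace x

/-- A simple cycle is clockwise if the faces on its right are enclosed by it. -/
def IsClockwiseCycle (Z : List D) : Prop :=
  G.IsSimpleCycle Z ∧ ∀ d ∈ Z, ¬ G.OutsideFace Z (G.right d)

/-- No clockwise cycle is residual. -/
def ClockwiseAcyclic (c : D → ℝ) : Prop :=
  ∀ Z, G.IsClockwiseCycle Z → ¬ IsResidual c Z

open Classical in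
/-- A flow with terminal set `T` with respect to the capacities `c`. -/
structure IsFlow (c : D → ℝ) (T : Set G.Vertex) (f : D → ℝ) : Prop where
  antisymm : ∀ d, f (G.rev d) = - f d
  le_cap : ∀ d, f d ≤ c d
  balanced : ∀ v, v ∉ T → ∑ d with G.tail d = v, f d = 0

open Classical in
/-- The net flow entering the vertex `v`. -/
noncomputable def inflow (f : D → ℝ) (v : G.Vertex) : ℝ := ∑ d with G.head d = v, f d

/-- `f` is the leftmost maximum `xy`-flow with respect to `c`: a maximum flow from `x` to `y`
such that no clockwise cycle is residual with respect to the residual capacities. -/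
structure IsLeftmostMaxFlow (c : D → ℝ) (x y : G.Vertex) (f : D → ℝ) : Prop where
  flow : G.IsFlow c {x, y} f
  maximum : ∀ g, G.IsFlow c {x, y} g → G.inflow g y ≤ G.inflow f y
  leftmost : G.ClockwiseAcyclic (fun d => c d - f d)

/-- The darts of the clockwise part of the boundary of `G` from `x` to `y`. Here and below, `x` and
`y` are darts of the boundary walk of the infinite face, marking the positions of their tails. -/
def boundaryArc (x y : D) : Set D :=
  {d | ∃ n : ℕ, d = (G.faceNext ^ n) x ∧ ∀ k ≤ n, (G.faceNext ^ k) x ≠ y}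

open Classical in
/-- The tail of the dual of `d` in the split dual with respect to `x` and `y`: the duals
of the darts on the boundary from `x` to `y` are incident to `a`, those of the darts on the boundary
from `y` to `x` are incident to `b`. -/
noncomputable def splitLeft (x y : D) (d : D) : SplitFace G.Face :=
  if d ∈ G.boundaryArc x y then SplitFace.a
  else if G.left d = G.infFace then SplitFace.b
  else SplitFace.inner (G.left d)

/-- The head of the dual of `d` in the split dual. -/
noncomputable def splitRight (x y : D) (d : D) : SplitFace G.Face := G.splitLeft x y (G.rev d)

/-- The list `W` of darts forms a path from `p` to `q` in the split dual. -/
def IsSplitPath (x y : D) (p : SplitFace G.Face) (W : List D) (q : SplitFace G.Face) : Prop :=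
  IsWalk (G.splitLeft x y) (G.splitRight x y) p W q

/-- `C` is a shortest path from `a` to `b` in the split dual and it is simple; that is, its darts form
a simple minimum cut between the tails of `x` and `y`. -/
def IsMinCut (c : D → ℝ) (x y : D) (C : List D) : Prop :=
  IsSimplePath (G.splitLeft x y) (G.splitRight x y) SplitFace.a C SplitFace.b ∧
    ∀ P, G.IsSplitPath x y SplitFace.a P SplitFace.b → length c C ≤ length c P

/-- The vertices on the side of `y` of the cut `C`. For a simple path `C` from `a` to `b` in the
split dual these are the dual faces that lie to the left of `C`. -/
def sinkSide (y : D) (C : List D) (v : G.Vertex) : Prop :=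
  Relation.ReflTransGen
    (fun u w => ∃ d, G.tail d = u ∧ G.head d = w ∧ d ∉ C ∧ G.rev d ∉ C) (G.tail y) v

/-- The dual path `W` lies (weakly) left of the simple dual path `C`: each of its dual edges
lies in the closed region left of `C`, i.e. bounds some dual face in that region. -/
def IsLeftOf (y : D) (W C : List D) : Prop :=
  ∀ d ∈ W, G.sinkSide y C (G.tail d) ∨ G.sinkSide y C (G.head d)

/-- `C` is the leftmost minimum cut: no other minimum cut is left of it. -/
def IsLeftmostMinCut (c : D → ℝ) (x y : D) (C : List D) : Prop :=
  G.IsMinCut c x y C ∧ ∀ P, G.IsMinCut c x y P → G.IsLeftOf y P C → P = C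

end PlaneGraph

/-- Alternating sources and sinks `s 0, t 0, s 1, t 1, …` on the infinite face, in clockwise
order. Each terminal is the tail of the given dart of the boundary walk; different terminals are
different vertices. -/
structure Terminals {D : Type*} [Fintype D] (G : PlaneGraph D) (m : ℕ) where
  s : Fin m → D
  t : Fin m → D
  distinct : Function.Injective (fun i => G.tail (Sum.elim s t i))
  clockwise : ∃ (r : D) (p q : Fin m → ℕ), G.left r = G.infFace ∧
    (∀ i, s i = (G.faceNext ^ p i) r ∧ t i = (G.faceNext ^ q i) r ∧
      p i < q i ∧ q i < Function.minimalPeriod G.faceNext r) ∧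
    ∀ i j, i < j → q i < p j

namespace Terminals

variable {D : Type*} [Fintype D] {G : PlaneGraph D} {m : ℕ} (K : Terminals G m)

def source (i : Fin m) : G.Vertex := G.tail (K.s i)

def sink (i : Fin m) : G.Vertex := G.tail (K.t i)

/-- `c₀` results from `c` by the first step of the algorithm: a flow is pushed after which
all paths from `s j` to `t i` with `i < j` and all clockwise cycles are non-residual. -/
structure IsPreprocessed (c c₀ : D → ℝ) : Prop where
  of_flow : ∃ f, G.IsFlow c (Set.range K.source ∪ Set.range K.sink) f ∧ ∀ d, c₀ d = c d - f d
  acyclic : G.ClockwiseAcyclic c₀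
  no_path : ∀ i j, i < j →
    ∀ P, IsWalk G.tail G.head (K.source j) P (K.sink i) → ¬ IsResidual c₀ P

/-- `IterationStart K c i j c'`: in an execution of the algorithm with capacities `c`, `c'` are the
current residual capacities at the start of iteration `(i, j)`. The outer loop runs over increasing
`j`, the inner loop over `i = j, j - 1, …, 0`. -/
inductive IterationStart (c : D → ℝ) : Fin m → Fin m → (D → ℝ) → Prop
  | first {z : Fin m} {c₀ : D → ℝ} (hz : z.val = 0) (h : K.IsPreprocessed c c₀) :
      IterationStart c z z c₀
  | inner {i k j : Fin m} {c' f : D → ℝ} (hk : k.val = i.val + 1) (h : IterationStart c k j c')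
      (hf : G.IsLeftmostMaxFlow c' (K.source k) (K.sink j) f) :
      IterationStart c i j (fun d => c' d - f d)
  | next {z l j : Fin m} {c' f : D → ℝ} (hz : z.val = 0) (hj : j.val = l.val + 1)
      (h : IterationStart c z l c')
      (hf : G.IsLeftmostMaxFlow c' (K.source z) (K.sink l) f) :
      IterationStart c j j (fun d => c' d - f d)

end Terminals

end BoundaryFlow

/-! Let v be the value of `f`, and call a dart tight if it is not residual after `f`. In a plane
graph a flow between two boundary vertices is a potential difference in the split dual: `f` is the
coboundary of some φ with φ(a) = 0 and φ(b) = v (`IsFlowOfValue.exists_splitPotential`; it rests on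
Euler's formula through a dimension count). Along tight dual darts φ does not decrease, because such
a dart carries its full, nonnegative capacity. Since `f` is leftmost, every face is reached from a
by a tight dual path (`IsPotential.reflTransGen`). Since W starts at a and has length v, a residual
dart d of W has φ < v on its right (`lt_of_mem`), and the tight dual path from a to that face stays
where φ < v, so it never visits b.

Suppose that a residual simple path R from s_k to t_l uses such a d. Each iteration closes its own
pair and reopens no closed one (`not_isResidual_sub`), so k ≤ l, j ≤ l, and k < i in case l = j.

If k < i, the arc from s_i to t_j lies in the arc from s_k to t_l, so the tight path to the face
right of d also starts at a in the split dual of (k, l). The potential of R cannot increase along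
tight darts, so it is at most 0 right of d. But the potential of a simple path is nonnegative and
increases across each dart of the path, a contradiction (`not_lt_of_isSimplePath`).

If k ≥ i, the tail of d is on the sink side of C because W is left of C. A residual path cannot
enter that side, C being tight, so s_k is there too and k > i. The pair (k, j) is closed, so some
tight dual path Z in the closed region left of C separates s_k from t_j; as C is leftmost, Z does
not separate s_i from t_j (`exists_tight_path`). If k ≤ j, then Z ends on the boundary between s_i
and s_k, hence also separates s_k from t_l and meets R. If k > j, then Z runs from b to b in the
split dual of (i, j), so φ ≥ v on both sides of its darts; but R up to d, continued along faces with
φ < v, leads from s_k to t_j and has to cross Z. -/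

namespace BoundaryFlow

/-! ### Circulations as coboundaries on the faces, from Euler's formula -/

namespace PlaneGraph

variable {D : Type*} [Fintype D] (G : PlaneGraph D)

theorem faceNext_apply (d : D) : G.faceNext d = G.rot⁻¹ (G.rev d) := rfl

theorem tail_eq_iff {d e : D} : G.tail d = G.tail e ↔ G.rot.SameCycle d e :=
  Quotient.eq (r := Equiv.Perm.SameCycle.setoid G.rot)

theorem left_eq_iff {d e : D} : G.left d = G.left e ↔ G.faceNext.SameCycle d e :=
  Quotient.eq (r := Equiv.Perm.SameCycle.setoid G.faceNext)

theorem exists_tail (v : G.Vertex) : ∃ d, G.tail d = v := Quotient.exists_rep v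

theorem exists_left (v : G.Face) : ∃ d, G.left d = v := Quotient.exists_rep v

@[simp] theorem tail_rot (d : D) : G.tail (G.rot d) = G.tail d :=
  G.tail_eq_iff.2 (Equiv.Perm.sameCycle_apply_left.2 (Equiv.Perm.SameCycle.refl _ _))

@[simp] theorem left_faceNext (d : D) : G.left (G.faceNext d) = G.left d :=
  G.left_eq_iff.2 (Equiv.Perm.sameCycle_apply_left.2 (Equiv.Perm.SameCycle.refl _ _))

@[simp] theorem left_faceNext_pow (n : ℕ) (d : D) : G.left ((G.faceNext ^ n) d) = G.left d :=
  G.left_eq_iff.2 (Equiv.Perm.sameCycle_pow_left.2 (Equiv.Perm.SameCycle.refl _ _))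

@[simp] theorem tail_rev (d : D) : G.tail (G.rev d) = G.head d := rfl

@[simp] theorem left_rev (d : D) : G.left (G.rev d) = G.right d := rfl

@[simp] theorem head_rev (d : D) : G.head (G.rev d) = G.tail d := by
  rw [head, G.rev_rev]

@[simp] theorem right_rev (d : D) : G.right (G.rev d) = G.left d := by
  rw [right, G.rev_rev]

@[simp] theorem tail_faceNext (d : D) : G.tail (G.faceNext d) = G.head d := by
  rw [← tail_rot]
  exact congrArg G.tail (G.rot.apply_symm_apply (G.rev d))

@[simp] theorem right_rot (d : D) : G.right (G.rot d) = G.left d := by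
  rw [right, ← left_faceNext, faceNext_apply, G.rev_rev]
  exact congrArg G.left (G.rot.symm_apply_apply d)

/-- A property of darts that is preserved by `rot` and `rev` holds for all darts or for none. -/
theorem dart_induction {p : D → Prop} (hrot : ∀ d, p d → p (G.rot d))
    (hrev : ∀ d, p d → p (G.rev d)) {d : D} (hd : p d) (e : D) : p e := by
  have h := G.connected d e
  induction h with
  | refl => exact hd
  | tail _ h ih =>
    rcases h with rfl | rfl
    exacts [hrot _ ih, hrev _ ih]

/-- `faceNext` has finite order, so closure under it gives closure under its inverse, and `rot` is
`rev` after that inverse. -/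
theorem dart_induction_faceNext {p : D → Prop} (hnext : ∀ d, p d → p (G.faceNext d))
    (hrev : ∀ d, p d → p (G.rev d)) {d : D} (hd : p d) (e : D) : p e := by
  have hinv : ∀ d, p d → p (G.faceNext⁻¹ d) := by
    intro d hd
    obtain ⟨n, hn⟩ := (isOfFinOrder_of_finite G.faceNext).exists_pow_eq_one
    have : ∀ k, p ((G.faceNext ^ k) d) := by
      intro k
      induction k with
      | zero => exact hd
      | succ k ih => rw [pow_succ']; exact hnext _ ih
    have h1 : G.faceNext⁻¹ = G.faceNext ^ (n - 1) := by
      rw [inv_eq_iff_mul_eq_one, ← pow_succ', Nat.sub_add_cancel hn.1, hn.2]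
    rw [h1]
    exact this _
  refine G.dart_induction (p := p) (fun d hd => ?_) hrev hd e
  have : G.rot d = G.rev (G.faceNext⁻¹ d) := by
    have h2 : G.faceNext (G.rev (G.rot d)) = d := by
      rw [faceNext_apply, G.rev_rev]
      exact G.rot.symm_apply_apply d
    rw [Equiv.Perm.inv_eq_iff_eq.2 h2.symm, G.rev_rev]
  rw [this]
  exact hrev _ (hinv _ hd)

theorem sum_comp_rev (g : D → ℝ) : ∑ d, g (G.rev d) = ∑ d, g d := Equiv.sum_comp G.rev g

/-- The coboundary of a function on the faces is balanced at every vertex. -/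
theorem sum_tail_mul_coboundary (φ : G.Face → ℝ) (h : G.Vertex → ℝ) :
    ∑ d, h (G.tail d) * (φ (G.right d) - φ (G.left d)) = 0 := by
  simp only [mul_sub, Finset.sum_sub_distrib]
  rw [sub_eq_zero, ← Equiv.sum_comp G.rot]
  simp

theorem sum_sub_mul_of_antisymm {g : D → ℝ} (hg : ∀ d, g (G.rev d) = - g d)
    (h : G.Vertex → ℝ) :
    ∑ d, (h (G.head d) - h (G.tail d)) * g d = -2 * ∑ d, h (G.tail d) * g d := by
  have h1 : ∑ d, h (G.head d) * g d = - ∑ d, h (G.tail d) * g d := by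
    rw [← G.sum_comp_rev, ← Finset.sum_neg_distrib]
    simp [hg]
  simp only [sub_mul, Finset.sum_sub_distrib, h1]
  ring

/-- Vertex coboundaries are orthogonal to face coboundaries and, by `h0`, this one is orthogonal to
`g` too; so the vertex part of `g` has norm zero. -/
theorem head_eq_tail_of_sum_eq_zero {h : G.Vertex → ℝ} {g : D → ℝ}
    (hg : ∀ d, g (G.rev d) = - g d) (h0 : ∑ d, h (G.tail d) * g d = 0)
    (hgh : ∃ φ : G.Face → ℝ, ∀ d, g d = h (G.head d) - h (G.tail d) +
      (φ (G.right d) - φ (G.left d))) (d : D) : h (G.head d) = h (G.tail d) := by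
  obtain ⟨φ, hφ⟩ := hgh
  have h1 := G.sum_sub_mul_of_antisymm hg h
  have h2 := G.sum_sub_mul_of_antisymm (g := fun d => φ (G.right d) - φ (G.left d))
    (by intro d; simp) h
  rw [h0] at h1
  rw [sum_tail_mul_coboundary] at h2
  have h3 : ∑ d, (h (G.head d) - h (G.tail d)) ^ 2 = 0 := by
    calc ∑ d, (h (G.head d) - h (G.tail d)) ^ 2
        = ∑ d, (h (G.head d) - h (G.tail d)) * g d -
          ∑ d, (h (G.head d) - h (G.tail d)) * (φ (G.right d) - φ (G.left d)) := by
          rw [← Finset.sum_sub_distrib]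
          exact Finset.sum_congr rfl fun d _ => by rw [hφ]; ring
      _ = 0 := by rw [h1, h2]; simp
  have h4 := (Finset.sum_eq_zero_iff_of_nonneg (fun _ _ => sq_nonneg _)).1 h3 d
    (Finset.mem_univ d)
  exact sub_eq_zero.1 (pow_eq_zero_iff two_ne_zero |>.1 h4)

theorem eq_const_of_head_eq_tail {h : G.Vertex → ℝ} (hh : ∀ d, h (G.head d) = h (G.tail d))
    (v : G.Vertex) : h v = h (G.tail G.outer) := by
  obtain ⟨d, rfl⟩ := G.exists_tail v
  exact G.dart_induction (p := fun d => h (G.tail d) = h (G.tail G.outer))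
    (fun d hd => by simpa using hd) (fun d hd => by simpa [hh] using hd) rfl d

theorem eq_const_of_right_eq_left {φ : G.Face → ℝ} (hh : ∀ d, φ (G.right d) = φ (G.left d))
    (v : G.Face) : φ v = φ (G.left G.outer) := by
  obtain ⟨d, rfl⟩ := G.exists_left v
  exact G.dart_induction_faceNext (p := fun d => φ (G.left d) = φ (G.left G.outer))
    (fun d hd => by simpa using hd) (fun d hd => by simpa [hh] using hd) rfl d

/-- The functions on the darts that are antisymmetric under reversal. -/
def antisymmetric : Submodule ℝ (D → ℝ) where
  carrier := {g | ∀ d, g (G.rev d) = - g d}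
  add_mem' := by
    intro a b ha hb d
    simp only [Pi.add_apply, ha d, hb d]
    ring
  zero_mem' := by intro d; simp
  smul_mem' := by
    intro r a ha d
    simp only [Pi.smul_apply, ha d, smul_eq_mul]
    ring

theorem two_mul_finrank_antisymmetric_le :
    2 * Module.finrank ℝ G.antisymmetric ≤ Fintype.card D := by
  classical
  let e := Fintype.equivFin D
  -- One dart of each edge, chosen by an arbitrary enumeration; an antisymmetric function is
  -- determined by its values there.
  let O : Finset D := Finset.univ.filter fun d => e d < e (G.rev d)
  have hO : 2 * O.card ≤ Fintype.card D := by
    have h1 : (O.image G.rev).card = O.card :=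
      Finset.card_image_of_injective _ G.rev.injective
    have h2 : Disjoint O (O.image G.rev) := by
      rw [Finset.disjoint_left]
      intro d hd hd'
      obtain ⟨d', hd1, rfl⟩ := Finset.mem_image.1 hd'
      simp only [O, Finset.mem_filter, G.rev_rev, Finset.mem_univ, true_and] at hd hd1
      exact lt_asymm hd hd1
    have h3 := Finset.card_le_univ (O ∪ O.image G.rev)
    rw [Finset.card_union_of_disjoint h2, h1] at h3
    omega
  let R : G.antisymmetric →ₗ[ℝ] (O → ℝ) :=
    { toFun := fun g o => g.1 o.1
      map_add' := fun _ _ => rfl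
      map_smul' := fun _ _ => rfl }
  have hR : Function.Injective R := by
    rw [← LinearMap.ker_eq_bot, LinearMap.ker_eq_bot']
    intro g hg
    have hgO : ∀ d ∈ O, g.1 d = 0 := fun d hd => congrFun hg ⟨d, hd⟩
    ext d
    change g.1 d = 0
    rcases lt_trichotomy (e d) (e (G.rev d)) with h | h | h
    · exact hgO d (by simp [O, h])
    · exact absurd (e.injective h).symm (G.rev_ne d)
    · have h2 := hgO (G.rev d) (by simp [O, h, G.rev_rev])
      have h3 := g.2 d
      rw [h2] at h3
      linarith
  have := LinearMap.finrank_le_finrank_of_injective hR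
  simp only [Module.finrank_fintype_fun_eq_card, Fintype.card_coe] at this
  omega

/-- The sum of the coboundaries of a function on the vertices and of a function on the faces. -/
def coboundarySum : ((G.Vertex → ℝ) × (G.Face → ℝ)) →ₗ[ℝ] (D → ℝ) where
  toFun p d := p.1 (G.head d) - p.1 (G.tail d) + (p.2 (G.right d) - p.2 (G.left d))
  map_add' := by
    intro a b
    ext d
    simp only [Prod.fst_add, Prod.snd_add, Pi.add_apply]
    ring
  map_smul' := by
    intro a b
    ext d
    simp only [Prod.smul_fst, Prod.smul_snd, Pi.smul_apply, smul_eq_mul, RingHom.id_apply]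
    ring

/-- By orthogonality both coboundaries vanish on the kernel, so by connectivity both functions are
constant. -/
theorem finrank_ker_coboundarySum_le : Module.finrank ℝ (LinearMap.ker G.coboundarySum) ≤ 2 := by
  let R : LinearMap.ker G.coboundarySum →ₗ[ℝ] ℝ × ℝ :=
    { toFun := fun p => (p.1.1 (G.tail G.outer), p.1.2 (G.left G.outer))
      map_add' := fun _ _ => rfl
      map_smul' := fun _ _ => rfl }
  have hR : Function.Injective R := by
    rw [← LinearMap.ker_eq_bot, LinearMap.ker_eq_bot']
    rintro ⟨⟨h, φ⟩, hk⟩ h0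
    have hk' : ∀ d, h (G.head d) - h (G.tail d) + (φ (G.right d) - φ (G.left d)) = 0 :=
      fun d => congrFun (LinearMap.mem_ker.1 hk) d
    have hh : ∀ d, h (G.head d) = h (G.tail d) :=
      G.head_eq_tail_of_sum_eq_zero (g := fun _ => 0) (by simp) (by simp)
        ⟨φ, fun d => (hk' d).symm⟩
    have hφ : ∀ d, φ (G.right d) = φ (G.left d) := fun d => by
      have := hk' d
      rw [hh] at this
      linarith
    have h0' : h (G.tail G.outer) = 0 ∧ φ (G.left G.outer) = 0 := Prod.mk.inj h0
    apply Subtype.ext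
    refine Prod.ext ?_ ?_
    · ext v
      exact (G.eq_const_of_head_eq_tail hh v).trans h0'.1
    · ext v
      exact (G.eq_const_of_right_eq_left hφ v).trans h0'.2
  have := LinearMap.finrank_le_finrank_of_injective hR
  simpa using this

/-- The range has dimension at least |V| + |F| - 2, which by Euler's formula is |E|, and the
antisymmetric functions have dimension at most |E|. -/
theorem range_coboundarySum : LinearMap.range G.coboundarySum = G.antisymmetric := by
  classical
  have : Fintype G.Vertex := Fintype.ofFinite _
  have : Fintype G.Face := Fintype.ofFinite _
  apply Submodule.eq_of_le_of_finrank_le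
  · rintro _ ⟨p, rfl⟩ d
    simp only [coboundarySum, LinearMap.coe_mk, AddHom.coe_mk, head_rev, tail_rev, right_rev,
      left_rev]
    ring
  · have h1 := LinearMap.finrank_range_add_finrank_ker G.coboundarySum
    have h2 := G.finrank_ker_coboundarySum_le
    have h3 := G.two_mul_finrank_antisymmetric_le
    have h4 := G.euler
    simp only [Module.finrank_prod, Module.finrank_fintype_fun_eq_card] at h1
    rw [Nat.card_eq_fintype_card (α := G.Vertex)] at h4
    change 2 * _ + 2 * Nat.card G.Face = _ at h4
    rw [Nat.card_eq_fintype_card (α := G.Face)] at h4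
    omega

/-- In a plane graph, every circulation is the coboundary of a function on the faces. -/
theorem exists_potential {g : D → ℝ} (hg : ∀ d, g (G.rev d) = - g d)
    (hbal : ∀ h : G.Vertex → ℝ, ∑ d, h (G.tail d) * g d = 0) :
    ∃ φ : G.Face → ℝ, ∀ d, g d = φ (G.right d) - φ (G.left d) := by
  have hmem : g ∈ LinearMap.range G.coboundarySum := by
    rw [range_coboundarySum]
    exact hg
  obtain ⟨⟨h, φ⟩, rfl⟩ := hmem
  have hh := G.head_eq_tail_of_sum_eq_zero hg (hbal h) ⟨φ, fun _ => rfl⟩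
  refine ⟨φ, fun d => ?_⟩
  simp [coboundarySum, hh]

end PlaneGraph

/-! ### Walks and simple paths -/

section Walks

variable {D X : Type*} {src tgt : D → X}

theorem isWalk_append_iff {P Q : List D} {u w : X} :
    IsWalk src tgt u (P ++ Q) w ↔ ∃ v, IsWalk src tgt u P v ∧ IsWalk src tgt v Q w := by
  induction P generalizing u with
  | nil => simp [IsWalk]
  | cons d P ih =>
    simp only [List.cons_append, IsWalk, ih]
    constructor
    · rintro ⟨h1, v, h2, h3⟩
      exact ⟨v, ⟨h1, h2⟩, h3⟩
    · rintro ⟨v, ⟨h1, h2⟩, h3⟩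
      exact ⟨h1, v, h2, h3⟩

theorem IsWalk.map_src_append {P : List D} {u w : X} (h : IsWalk src tgt u P w) :
    P.map src ++ [w] = u :: P.map tgt := by
  induction P generalizing u with
  | nil => simpa [IsWalk] using (h : u = w).symm
  | cons d P ih =>
    obtain ⟨rfl, h2⟩ := h
    simp [ih h2]

theorem isWalk_singleton (d : D) : IsWalk src tgt (src d) [d] (tgt d) := ⟨rfl, rfl⟩

theorem exists_isWalk_of_reflTransGen {Q : D → Prop} {u w : X}
    (h : Relation.ReflTransGen (fun p q => ∃ d, src d = p ∧ tgt d = q ∧ Q d) u w) :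
    ∃ P, IsWalk src tgt u P w ∧ ∀ d ∈ P, Q d := by
  induction h with
  | refl => exact ⟨[], rfl, by simp⟩
  | tail _ h ih =>
    obtain ⟨P, hP, hQ⟩ := ih
    obtain ⟨d, rfl, rfl, hd⟩ := h
    refine ⟨P ++ [d], isWalk_append_iff.2 ⟨_, hP, isWalk_singleton d⟩, fun e he => ?_⟩
    rcases List.mem_append.1 he with he | he
    · exact hQ e he
    · rwa [List.mem_singleton.1 he]

theorem IsWalk.reflTransGen {Q : D → Prop} {P : List D} {u w : X} (h : IsWalk src tgt u P w)
    (hQ : ∀ d ∈ P, Q d) :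
    Relation.ReflTransGen (fun p q => ∃ d, src d = p ∧ tgt d = q ∧ Q d) u w := by
  induction P generalizing u with
  | nil => rw [(h : u = w)]
  | cons d P ih =>
    obtain ⟨rfl, h2⟩ := h
    exact Relation.ReflTransGen.head ⟨d, rfl, rfl, hQ d (by simp)⟩
      (ih h2 fun e he => hQ e (by simp [he]))

theorem IsSimplePath.exists_suffix {P : List D} {u v w : X} (h : IsSimplePath src tgt u P w)
    (hv : v ∈ u :: P.map tgt) : ∃ P', IsSimplePath src tgt v P' w ∧ P' ⊆ P := by
  induction P generalizing u with
  | nil =>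
    rw [List.map_nil, List.mem_singleton] at hv
    exact ⟨[], hv ▸ h, by simp⟩
  | cons d P ih =>
    by_cases hu : v = u
    · exact ⟨d :: P, hu ▸ h, by simp⟩
    · obtain ⟨⟨_, h2⟩, h3⟩ := h
      have h4 : v ∈ tgt d :: P.map tgt := by simpa [hu] using hv
      obtain ⟨P', hP', hs⟩ := ih ⟨h2, (List.nodup_cons.1 h3).2⟩ h4
      exact ⟨P', hP', List.Subset.trans hs (List.subset_cons_self _ _)⟩

theorem IsWalk.exists_isSimplePath {P : List D} {u w : X} (h : IsWalk src tgt u P w) :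
    ∃ P', IsSimplePath src tgt u P' w ∧ P' ⊆ P := by
  induction P generalizing u with
  | nil => exact ⟨[], ⟨h, by simp⟩, by simp⟩
  | cons d P ih =>
    obtain ⟨rfl, h2⟩ := h
    obtain ⟨P', hP', hs⟩ := ih h2
    by_cases hu : src d ∈ tgt d :: P'.map tgt
    · obtain ⟨P'', hP'', hs'⟩ := hP'.exists_suffix hu
      exact ⟨P'', hP'', List.Subset.trans (List.Subset.trans hs' hs) (List.subset_cons_self _ _)⟩
    · exact ⟨d :: P', ⟨⟨rfl, hP'.1⟩, List.nodup_cons.2 ⟨hu, hP'.2⟩⟩,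
        List.cons_subset_cons _ hs⟩

theorem IsSimplePath.nodup_map_src {P : List D} {u w : X} (h : IsSimplePath src tgt u P w) :
    (P.map src).Nodup := by
  have := h.2
  rw [← h.1.map_src_append] at this
  exact this.of_append_left

theorem IsSimplePath.nodup {P : List D} {u w : X} (h : IsSimplePath src tgt u P w) : P.Nodup :=
  h.nodup_map_src.of_map

theorem IsSimplePath.eq_of_src_eq {P : List D} {u w : X} (h : IsSimplePath src tgt u P w)
    {d e : D} (hd : d ∈ P) (he : e ∈ P) (hde : src d = src e) : d = e :=
  List.inj_on_of_nodup_map h.nodup_map_src hd he hde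

theorem IsSimplePath.eq_of_tgt_eq {P : List D} {u w : X} (h : IsSimplePath src tgt u P w)
    {d e : D} (hd : d ∈ P) (he : e ∈ P) (hde : tgt d = tgt e) : d = e :=
  List.inj_on_of_nodup_map (List.nodup_cons.1 h.2).2 hd he hde

/-- On a simple path, the dart that enters the tail of a dart `e` precedes `e`. -/
theorem IsSimplePath.mem_prefix {P Q : List D} {d e : D} {u w : X}
    (h : IsSimplePath src tgt u (P ++ e :: Q) w) (hd : d ∈ P ++ e :: Q) (hde : tgt d = src e) :
    d ∈ P := by
  by_contra hdP
  have hd' : d ∈ e :: Q := by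
    rcases List.mem_append.1 hd with h1 | h1
    exacts [absurd h1 hdP, h1]
  obtain ⟨v, h1, h2⟩ := isWalk_append_iff.1 h.1
  obtain ⟨rfl, -⟩ := id h2
  have h3 : (u :: P.map tgt ++ (e :: Q).map tgt).Nodup := by simpa using h.2
  have h4 : src e ∈ u :: P.map tgt := by
    rw [← h1.map_src_append]
    simp
  exact (List.nodup_append.1 h3).2.2 _ h4 _ (hde ▸ List.mem_map_of_mem hd') rfl

theorem sum_map_coboundary (ψ : X → ℝ) {Z : List D} {p q : X}
    (hZ : IsWalk src tgt p Z q) : (Z.map fun d => ψ (tgt d) - ψ (src d)).sum = ψ q - ψ p := by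
  induction Z generalizing p with
  | nil =>
    obtain rfl : p = q := hZ
    simp
  | cons d Z ih =>
    obtain ⟨rfl, h⟩ := hZ
    rw [List.map_cons, List.sum_cons, ih h]
    ring

theorem exists_pos_le_of_isResidual {c : D → ℝ} {P : List D} (hP : IsResidual c P) :
    ∃ r > 0, ∀ d ∈ P, r ≤ c d := by
  induction P with
  | nil => exact ⟨1, one_pos, by simp⟩
  | cons d P ih =>
    obtain ⟨r, hr, h⟩ := ih fun e he => hP e (by simp [he])
    refine ⟨min r (c d), lt_min hr (hP d (by simp)), fun e he => ?_⟩
    rcases List.mem_cons.1 he with rfl | he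
    · exact min_le_right _ _
    · exact (min_le_left _ _).trans (h e he)

end Walks

/-! ### Flows of given value -/

namespace PlaneGraph

variable {D : Type*} [Fintype D] (G : PlaneGraph D)

/-- Each of `d` and `rev d` would have to precede the other on the path. -/
theorem rev_notMem_of_isSimplePath {R : List D} {u w : G.Vertex}
    (h : IsSimplePath G.tail G.head u R w) {d : D} (hd : d ∈ R) : G.rev d ∉ R := by
  intro hrev
  obtain ⟨P, Q, rfl⟩ := List.append_of_mem hd
  have h1 := h.mem_prefix hrev (by simp)
  obtain ⟨P', Q', rfl⟩ := List.append_of_mem h1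
  have h2 : d ∈ P' := by
    refine IsSimplePath.mem_prefix (e := G.rev d) (Q := Q' ++ d :: Q) (u := u) (w := w)
      (src := G.tail) (tgt := G.head) ?_ ?_ (by simp)
    · simpa using h
    · simp
  have h3 := h.nodup
  rw [List.nodup_append] at h3
  exact h3.2.2 d (by simp [h2]) d (by simp) rfl

/-- `g` is antisymmetric and sends `v` units from `u` to `w`. -/
structure IsFlowOfValue (g : D → ℝ) (u w : G.Vertex) (v : ℝ) : Prop where
  antisymm : ∀ d, g (G.rev d) = - g d
  sum_mul : ∀ h : G.Vertex → ℝ, ∑ d, h (G.tail d) * g d = v * (h u - h w)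

variable {G} in
theorem IsFlowOfValue.add_smul {g g' : D → ℝ} {u w : G.Vertex} {v v' : ℝ}
    (hg : G.IsFlowOfValue g u w v) (hg' : G.IsFlowOfValue g' u w v') (r : ℝ) :
    G.IsFlowOfValue (fun d => g d + r * g' d) u w (v + r * v') where
  antisymm d := by rw [hg.antisymm, hg'.antisymm]; ring
  sum_mul h := by
    have : ∀ d, h (G.tail d) * (g d + r * g' d) =
        h (G.tail d) * g d + r * (h (G.tail d) * g' d) := fun d => by ring
    simp only [this, Finset.sum_add_distrib, ← Finset.mul_sum, hg.sum_mul, hg'.sum_mul]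
    ring

open Classical in
/-- The flow along a path. -/
noncomputable def walkFlow (P : List D) (d : D) : ℝ := P.count d - P.count (G.rev d)

theorem mem_of_walkFlow_pos {P : List D} {d : D} (h : 0 < G.walkFlow P d) : d ∈ P := by
  classical
  by_contra hd
  rw [walkFlow, List.count_eq_zero_of_not_mem hd] at h
  simp only [Nat.cast_zero, zero_sub, Left.neg_pos_iff] at h
  exact absurd h (not_lt.2 (Nat.cast_nonneg _))

theorem walkFlow_pos {P : List D} {d : D} (h : d ∈ P) (h' : G.rev d ∉ P) :
    0 < G.walkFlow P d := by
  classical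
  rw [walkFlow, List.count_eq_zero_of_not_mem h']
  simpa using h

theorem walkFlow_isFlowOfValue {P : List D} {u w : G.Vertex}
    (h : IsWalk G.tail G.head u P w) : G.IsFlowOfValue (G.walkFlow P) u w 1 where
  antisymm d := by rw [walkFlow, walkFlow, G.rev_rev]; ring
  sum_mul k := by
    classical
    induction P generalizing u with
    | nil =>
      obtain rfl : u = w := h
      simp [walkFlow]
    | cons e P ih =>
      obtain ⟨rfl, h2⟩ := h
      have h3 : ∀ d, k (G.tail d) * G.walkFlow (e :: P) d = k (G.tail d) * G.walkFlow P d +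
          ((if d = e then k (G.tail d) else 0) - if d = G.rev e then k (G.tail d) else 0) := by
        intro d
        have h4 : (e = G.rev d) = (d = G.rev e) := propext
          ⟨fun h => by rw [h, G.rev_rev], fun h => by rw [h, G.rev_rev]⟩
        simp only [walkFlow, List.count_cons, beq_iff_eq, h4, eq_comm (a := e)]
        split_ifs <;> push_cast <;> ring
      simp only [h3, Finset.sum_add_distrib, Finset.sum_sub_distrib, ih h2,
        Finset.sum_ite_eq', Finset.mem_univ, if_true, tail_rev]
      ring

-- Grouping the darts by tail leaves only the terms at `x` and `y`; these are opposite because an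
-- antisymmetric function has total zero.
variable {G} in
open Classical in
theorem IsFlow.isFlowOfValue {c f : D → ℝ} {x y : G.Vertex} (hxy : x ≠ y)
    (hf : G.IsFlow c {x, y} f) : G.IsFlowOfValue f x y (G.inflow f y) where
  antisymm := hf.antisymm
  sum_mul h := by
    have : Fintype G.Vertex := Fintype.ofFinite _
    have hfib : ∀ h : G.Vertex → ℝ, ∑ d, h (G.tail d) * f d =
        ∑ v, h v * ∑ d with G.tail d = v, f d := by
      intro h
      rw [← Finset.sum_fiberwise (s := Finset.univ) (g := G.tail)]
      refine Finset.sum_congr rfl fun v _ => ?_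
      rw [Finset.mul_sum]
      refine Finset.sum_congr rfl fun d hd => ?_
      rw [(Finset.mem_filter.1 hd).2]
    have htwo : ∀ h : G.Vertex → ℝ, ∑ d, h (G.tail d) * f d =
        h x * (∑ d with G.tail d = x, f d) + h y * ∑ d with G.tail d = y, f d := by
      intro h
      rw [hfib, ← Finset.sum_pair (f := fun v => h v * ∑ d with G.tail d = v, f d) hxy]
      refine (Finset.sum_subset (Finset.subset_univ _) fun v _ hv => ?_).symm
      rw [hf.balanced v (by simpa using hv), mul_zero]
    have hin : G.inflow f y = - ∑ d with G.tail d = y, f d := by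
      rw [inflow, Finset.sum_filter, Finset.sum_filter, ← G.sum_comp_rev,
        ← Finset.sum_neg_distrib]
      refine Finset.sum_congr rfl fun d _ => ?_
      rw [head_rev, hf.antisymm]
      split_ifs <;> simp
    have hzero : ∑ d, (1 : G.Vertex → ℝ) (G.tail d) * f d = 0 := by
      have h1 : ∑ d, f (G.rev d) = ∑ d, f d := G.sum_comp_rev f
      simp only [hf.antisymm, Finset.sum_neg_distrib] at h1
      simp only [Pi.one_apply, one_mul]
      linarith
    rw [htwo] at hzero ⊢
    simp only [Pi.one_apply, one_mul] at hzero
    rw [hin, eq_neg_of_add_eq_zero_left hzero]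
    ring

variable {G} in
open Classical in
theorem IsFlowOfValue.sum_tail {g : D → ℝ} {x y : G.Vertex} {v : ℝ}
    (hg : G.IsFlowOfValue g x y v) (z : G.Vertex) :
    ∑ d with G.tail d = z, g d = v * ((if x = z then 1 else 0) - if y = z then 1 else 0) := by
  rw [← hg.sum_mul (fun w => if w = z then 1 else 0), Finset.sum_filter]
  exact Finset.sum_congr rfl fun d _ => by split_ifs <;> simp

variable {G} in
theorem IsFlowOfValue.isFlow {c g : D → ℝ} {x y : G.Vertex} {v : ℝ}
    (hg : G.IsFlowOfValue g x y v) (hc : ∀ d, g d ≤ c d) : G.IsFlow c {x, y} g where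
  antisymm := hg.antisymm
  le_cap := hc
  balanced z hz := by
    classical
    rw [Set.mem_insert_iff, Set.mem_singleton_iff, not_or] at hz
    have := hg.sum_tail z
    rw [if_neg (Ne.symm hz.1), if_neg (Ne.symm hz.2)] at this
    simpa using this

variable {G} in
theorem IsFlowOfValue.inflow_eq {g : D → ℝ} {x y : G.Vertex} {v : ℝ}
    (hg : G.IsFlowOfValue g x y v) (hxy : x ≠ y) : G.inflow g y = v := by
  have h1 := (hg.isFlow (c := g) fun _ => le_rfl).isFlowOfValue hxy
  classical
  have h2 := (h1.sum_mul (fun w => if w = y then 1 else 0)).symm.trans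
    (hg.sum_mul (fun w => if w = y then 1 else 0))
  simpa [hxy] using h2

/-- The net flow out of a set of vertices is the total flow on the darts that leave it. -/
theorem IsFlowOfValue.sum_leaving {G : PlaneGraph D} {g : D → ℝ} {x y : G.Vertex} {v : ℝ}
    (hg : G.IsFlowOfValue g x y v) (S : Set G.Vertex) [DecidablePred (· ∈ S)] :
    ∑ d, (if G.tail d ∈ S ∧ G.head d ∉ S then g d else 0) =
      v * ((if x ∈ S then 1 else 0) - if y ∈ S then 1 else 0) := by
  -- Darts with both ends in `S` cancel against their reversals.
  have h1 : ∑ d, (if G.tail d ∈ S ∧ G.head d ∈ S then g d else 0) = 0 := by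
    have h2 := G.sum_comp_rev (fun d => if G.tail d ∈ S ∧ G.head d ∈ S then g d else 0)
    have h3 : ∀ d, (if G.tail (G.rev d) ∈ S ∧ G.head (G.rev d) ∈ S then g (G.rev d) else 0) =
        - if G.tail d ∈ S ∧ G.head d ∈ S then g d else 0 := by
      intro d
      by_cases ht : G.tail d ∈ S <;> by_cases hh : G.head d ∈ S <;> simp [ht, hh, hg.antisymm]
    simp only [h3, Finset.sum_neg_distrib] at h2
    linarith
  have h4 : ∑ d, (if G.tail d ∈ S then 1 else 0) * g d =
      ∑ d, (if G.tail d ∈ S ∧ G.head d ∉ S then g d else 0) +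
        ∑ d, (if G.tail d ∈ S ∧ G.head d ∈ S then g d else 0) := by
    rw [← Finset.sum_add_distrib]
    refine Finset.sum_congr rfl fun d _ => ?_
    by_cases ht : G.tail d ∈ S <;> by_cases hh : G.head d ∈ S <;> simp [ht, hh]
  rw [h1, add_zero] at h4
  rw [← h4]
  exact hg.sum_mul (fun w => if w ∈ S then 1 else 0)

/-! ### Boundary arcs and duality in the split dual -/

theorem isWalk_faceNext (x : D) (n : ℕ) :
    IsWalk G.tail G.head (G.tail x) ((List.range n).map fun k => (G.faceNext ^ k) x)
      (G.tail ((G.faceNext ^ n) x)) := by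
  induction n with
  | zero => simp [IsWalk]
  | succ n ih =>
    rw [List.range_succ, List.map_append]
    refine isWalk_append_iff.2 ⟨_, ih, rfl, ?_⟩
    rw [pow_succ', Equiv.Perm.mul_apply, tail_faceNext]
    rfl

theorem left_of_mem_boundaryArc {x y d : D} (h : d ∈ G.boundaryArc x y) :
    G.left d = G.left x := by
  obtain ⟨n, rfl, -⟩ := h
  simp

/-- The first `n` with `faceNext ^ n` taking `x` to `y`, for `x` and `y` on the same face. -/
theorem exists_first_pow {x y : D} (h : G.left x = G.left y) (hne : x ≠ y) :
    ∃ n, 0 < n ∧ (G.faceNext ^ n) x = y ∧ ∀ k < n, (G.faceNext ^ k) x ≠ y := by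
  classical
  have hex : ∃ n : ℕ, (G.faceNext ^ n) x = y := by
    exact (G.left_eq_iff.1 h).exists_nat_pow_eq
  refine ⟨Nat.find hex, ?_, Nat.find_spec hex, fun k hk => Nat.find_min hex hk⟩
  rw [Nat.pos_iff_ne_zero]
  intro h0
  have := Nat.find_spec hex
  rw [h0] at this
  exact hne this

theorem injOn_of_first_pow {x y : D} {n : ℕ} (h : (G.faceNext ^ n) x = y)
    (hmin : ∀ k < n, (G.faceNext ^ k) x ≠ y) {a b : ℕ} (hab : a < b) (hb : b < n) :
    (G.faceNext ^ a) x ≠ (G.faceNext ^ b) x := by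
  intro he
  -- A repetition could be skipped, and `y` would be reached `b - a` steps earlier.
  apply hmin (n - (b - a)) (by omega)
  have h1 : n - (b - a) = (n - b) + a := by omega
  rw [h1, pow_add, Equiv.Perm.mul_apply, he, ← Equiv.Perm.mul_apply, ← pow_add,
    Nat.sub_add_cancel hb.le, h]

theorem mem_boundaryArc_iff {x y d : D} {n : ℕ} (h : (G.faceNext ^ n) x = y)
    (hmin : ∀ k < n, (G.faceNext ^ k) x ≠ y) :
    d ∈ G.boundaryArc x y ↔ ∃ k < n, d = (G.faceNext ^ k) x := by
  constructor
  · rintro ⟨k, rfl, hk⟩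
    refine ⟨k, ?_, rfl⟩
    by_contra hkn
    exact hk n (not_lt.1 hkn) h
  · rintro ⟨k, hk, rfl⟩
    exact ⟨k, rfl, fun l hl => hmin l (hl.trans_lt hk)⟩

open Classical in
/-- The part of the boundary from `x` to `y` is a path. -/
theorem exists_boundaryArc_walk {x y : D} (h : G.left x = G.left y) (hne : x ≠ y) :
    ∃ P, IsWalk G.tail G.head (G.tail x) P (G.tail y) ∧ (∀ d, d ∈ P ↔ d ∈ G.boundaryArc x y) ∧
      ∀ d, G.walkFlow P d = (if d ∈ G.boundaryArc x y then 1 else 0) -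
        if G.rev d ∈ G.boundaryArc x y then 1 else 0 := by
  obtain ⟨n, -, hn, hmin⟩ := G.exists_first_pow h hne
  have hmem : ∀ d, d ∈ (List.range n).map (fun k => (G.faceNext ^ k) x) ↔
      d ∈ G.boundaryArc x y := fun d => by
    rw [G.mem_boundaryArc_iff hn hmin]
    simp [eq_comm]
  have hnd : ((List.range n).map fun k => (G.faceNext ^ k) x).Nodup := by
    refine List.Nodup.map_on (fun a ha b hb hab => ?_) List.nodup_range
    rw [List.mem_range] at ha hb
    rcases lt_trichotomy a b with h1 | h1 | h1
    · exact absurd hab (G.injOn_of_first_pow hn hmin h1 hb)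
    · exact h1
    · exact absurd hab.symm (G.injOn_of_first_pow hn hmin h1 ha)
  refine ⟨_, hn ▸ G.isWalk_faceNext x n, hmem, fun d => ?_⟩
  rw [walkFlow, List.Nodup.count hnd, List.Nodup.count hnd]
  simp only [hmem]
  push_cast
  rfl

/-- The function on the split faces with the values `0` at `a` and `v` at `b`. -/
def splitPotential (φ : G.Face → ℝ) (v : ℝ) : SplitFace G.Face → ℝ
  | SplitFace.a => 0
  | SplitFace.b => v
  | SplitFace.inner F => φ F

open Classical in
theorem splitPotential_splitLeft {φ : G.Face → ℝ} {v : ℝ} (hφ : φ G.infFace = v) {x y : D}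
    (hx : G.left x = G.infFace) (d : D) :
    G.splitPotential φ v (G.splitLeft x y d) =
      φ (G.left d) - v * if d ∈ G.boundaryArc x y then 1 else 0 := by
  rw [splitLeft]
  by_cases h1 : d ∈ G.boundaryArc x y
  · have h2 := G.left_of_mem_boundaryArc h1
    simp [h1, h2, hx, hφ, splitPotential]
  · by_cases h2 : G.left d = G.infFace
    · simp [h1, h2, hφ, splitPotential]
    · simp [h1, h2, splitPotential]

/-- The coboundary of a function on the split faces is a flow. -/
theorem isFlowOfValue_splitCoboundary {x y : D} (hx : G.left x = G.infFace)
    (hy : G.left y = G.infFace) (hne : x ≠ y) (ψ : SplitFace G.Face → ℝ) :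
    G.IsFlowOfValue (fun d => ψ (G.splitRight x y d) - ψ (G.splitLeft x y d)) (G.tail x)
      (G.tail y) (ψ SplitFace.b - ψ SplitFace.a) := by
  classical
  obtain ⟨P, hP, -, hflow⟩ := G.exists_boundaryArc_walk (hx.trans hy.symm) hne
  let φ : G.Face → ℝ := fun F => if F = G.infFace then ψ SplitFace.b - ψ SplitFace.a else
    ψ (SplitFace.inner F) - ψ SplitFace.a
  have hφ : φ G.infFace = ψ SplitFace.b - ψ SplitFace.a := by simp [φ]
  have h1 : ∀ d, ψ (G.splitLeft x y d) = ψ SplitFace.a +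
      G.splitPotential φ (ψ SplitFace.b - ψ SplitFace.a) (G.splitLeft x y d) := by
    intro d
    rw [splitLeft]
    split_ifs with h1 h2 <;> simp [splitPotential, φ, *]
  have h2 := IsFlowOfValue.add_smul (g := fun d => φ (G.right d) - φ (G.left d)) (v := 0)
    ⟨fun d => by simp, fun h => by rw [sum_tail_mul_coboundary]; simp⟩
    (G.walkFlow_isFlowOfValue hP) (ψ SplitFace.b - ψ SplitFace.a)
  convert h2 using 1
  · ext d
    rw [splitRight, h1 d, h1 (G.rev d), splitPotential_splitLeft _ hφ hx,
      splitPotential_splitLeft _ hφ hx, left_rev, hflow]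
    ring
  · ring

/-- Every flow between two boundary vertices is the coboundary of a function on the split faces. -/
theorem IsFlowOfValue.exists_splitPotential {G : PlaneGraph D} {x y : D}
    (hx : G.left x = G.infFace) (hy : G.left y = G.infFace) (hne : x ≠ y) {g : D → ℝ} {v : ℝ}
    (hg : G.IsFlowOfValue g (G.tail x) (G.tail y) v) :
    ∃ ψ : SplitFace G.Face → ℝ, ψ SplitFace.a = 0 ∧ ψ SplitFace.b = v ∧
      ∀ d, g d = ψ (G.splitRight x y d) - ψ (G.splitLeft x y d) := by
  classical
  obtain ⟨P, hP, -, hflow⟩ := G.exists_boundaryArc_walk (hx.trans hy.symm) hne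
  -- Sending `v` units back along the boundary arc leaves a circulation, which has a potential on
  -- the unsplit faces. The jump `v` across the arc is what separates a from b.
  have h1 := hg.add_smul (G.walkFlow_isFlowOfValue hP) (-v)
  obtain ⟨φ, hφ⟩ := G.exists_potential h1.antisymm fun h => by rw [h1.sum_mul]; ring
  refine ⟨G.splitPotential (fun F => φ F + (v - φ G.infFace)) v, rfl, rfl, fun d => ?_⟩
  rw [splitRight, splitPotential_splitLeft _ (by simp) hx, splitPotential_splitLeft _ (by simp) hx,
    left_rev]
  have h2 := hφ d
  rw [hflow] at h2
  linarith

/-- A dual path from `a` to `b` and a path from `x` to `y` have a dart in common. -/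
theorem exists_mem_of_walk_of_splitPath {x y : D} (hx : G.left x = G.infFace)
    (hy : G.left y = G.infFace) (hne : x ≠ y) {P Z : List D}
    (hP : IsWalk G.tail G.head (G.tail x) P (G.tail y))
    (hZ : G.IsSplitPath x y SplitFace.a Z SplitFace.b) : ∃ d ∈ Z, d ∈ P := by
  obtain ⟨ψ, ha, hb, hψ⟩ := (G.walkFlow_isFlowOfValue hP).exists_splitPotential hx hy hne
  have h1 := sum_map_coboundary ψ hZ
  simp only [← hψ, ha, hb] at h1
  by_contra! hno
  have h2 : (Z.map (G.walkFlow P)).sum ≤ 0 := by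
    have h3 : (Z.map (G.walkFlow P)).sum ≤ (Z.map fun _ => (0 : ℝ)).sum :=
      List.sum_le_sum fun d hd => not_lt.1 fun h => hno d hd (G.mem_of_walkFlow_pos h)
    simpa using h3
  have h3 : (Z.map fun d => G.walkFlow P d).sum = (Z.map (G.walkFlow P)).sum := rfl
  linarith

/-- For every set `Q` of darts there is a dual path from `a` to `b` inside `Q` or a path from `x`
to `y` outside `Q`. -/
theorem exists_splitPath_or_exists_walk {x y : D} (hx : G.left x = G.infFace)
    (hy : G.left y = G.infFace) (hne : x ≠ y) (Q : D → Prop) :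
    (∃ Z, IsSimplePath (G.splitLeft x y) (G.splitRight x y) SplitFace.a Z SplitFace.b ∧
      ∀ d ∈ Z, Q d) ∨
    ∃ P, IsWalk G.tail G.head (G.tail x) P (G.tail y) ∧ ∀ d ∈ P, ¬ Q d := by
  classical
  let U : Set (SplitFace G.Face) := {p | Relation.ReflTransGen
    (fun p q => ∃ d, G.splitLeft x y d = p ∧ G.splitRight x y d = q ∧ Q d) SplitFace.a p}
  let S : Set G.Vertex := {v | Relation.ReflTransGen
    (fun u w => ∃ d, G.tail d = u ∧ G.head d = w ∧ ¬ Q d) (G.tail x) v}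
  by_cases hb : SplitFace.b ∈ U
  · obtain ⟨Z, hZ, hQ⟩ := exists_isWalk_of_reflTransGen hb
    obtain ⟨Z', hZ', hs⟩ := hZ.exists_isSimplePath
    exact Or.inl ⟨Z', hZ', fun d hd => hQ d (hs hd)⟩
  by_cases hy' : G.tail y ∈ S
  · exact Or.inr (exists_isWalk_of_reflTransGen hy')
  exfalso
  have ha : SplitFace.a ∈ U := Relation.ReflTransGen.refl
  have hx' : G.tail x ∈ S := Relation.ReflTransGen.refl
  -- The coboundary of this 0/1 function is a unit flow from `x` to `y`, so its net flow out of `S`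
  -- is 1. But a dart leaving `S` satisfies `Q`, hence does not lead from `U` out of `U` and
  -- contributes at most 0.
  let ψ : SplitFace G.Face → ℝ := fun p => if p ∈ U then 0 else 1
  have h1 := (G.isFlowOfValue_splitCoboundary hx hy hne ψ).sum_leaving S
  have h2 : ψ SplitFace.b - ψ SplitFace.a = 1 := by simp [ψ, ha, hb]
  rw [h2, if_pos hx', if_neg hy'] at h1
  have h3 : ∑ d, (if G.tail d ∈ S ∧ G.head d ∉ S then
      ψ (G.splitRight x y d) - ψ (G.splitLeft x y d) else 0) ≤ 0 := by
    refine Finset.sum_nonpos fun d _ => ?_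
    split_ifs with hd
    · have hQ : Q d := by
        by_contra hQ
        exact hd.2 (Relation.ReflTransGen.tail hd.1 ⟨d, rfl, rfl, hQ⟩)
      by_cases hl : G.splitLeft x y d ∈ U
      · have hr : G.splitRight x y d ∈ U := Relation.ReflTransGen.tail hl ⟨d, rfl, rfl, hQ⟩
        simp [ψ, hl, hr]
      · simp only [ψ, hl, if_false]
        split_ifs <;> norm_num
    · exact le_rfl
  linarith

theorem splitLeft_of_left_ne {x y d : D} (hx : G.left x = G.infFace)
    (hd : G.left d ≠ G.infFace) : G.splitLeft x y d = SplitFace.inner (G.left d) := by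
  rw [splitLeft, if_neg fun h => hd ((G.left_of_mem_boundaryArc h).trans hx), if_neg hd]

theorem splitLeft_of_mem {x y d : D} (hd : d ∈ G.boundaryArc x y) :
    G.splitLeft x y d = SplitFace.a := by
  rw [splitLeft, if_pos hd]

theorem splitLeft_of_notMem {x y d : D} (hd : G.left d = G.infFace)
    (h : d ∉ G.boundaryArc x y) : G.splitLeft x y d = SplitFace.b := by
  rw [splitLeft, if_neg h, if_pos hd]

theorem splitLeft_eq_a_iff {x y d : D} :
    G.splitLeft x y d = SplitFace.a ↔ d ∈ G.boundaryArc x y := by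
  rw [splitLeft]
  split_ifs <;> simp [*]

theorem splitLeft_eq_b_iff {x y d : D} :
    G.splitLeft x y d = SplitFace.b ↔ G.left d = G.infFace ∧ d ∉ G.boundaryArc x y := by
  rw [splitLeft]
  split_ifs <;> simp [*]

theorem splitLeft_eq_inner_iff {x y d : D} (hx : G.left x = G.infFace) {F : G.Face} :
    G.splitLeft x y d = SplitFace.inner F ↔ G.left d = F ∧ F ≠ G.infFace := by
  constructor
  · intro h
    rw [splitLeft] at h
    split_ifs at h with h1 h2
    obtain rfl := SplitFace.inner.inj h
    exact ⟨rfl, h2⟩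
  · rintro ⟨rfl, h⟩
    exact G.splitLeft_of_left_ne hx h

variable {G} in
theorem IsFlowOfValue.exists_next {g : D → ℝ} {u w : G.Vertex} (hg : G.IsFlowOfValue g u w 0)
    {e : D} (he : 0 < g e) : ∃ e', G.tail e' = G.head e ∧ 0 < g e' := by
  classical
  have h1 := hg.sum_tail (G.head e)
  rw [zero_mul] at h1
  by_contra! hno
  have h2 := (Finset.sum_eq_zero_iff_of_nonpos
    (fun d hd => hno d (Finset.mem_filter.1 hd).2)).1 h1 (G.rev e) (by simp)
  rw [hg.antisymm] at h2
  linarith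

variable {G} in
theorem IsFlowOfValue.exists_prev {g : D → ℝ} {u w : G.Vertex} (hg : G.IsFlowOfValue g u w 0)
    {e : D} (he : 0 < g e) : ∃ e', G.head e' = G.tail e ∧ 0 < g e' := by
  classical
  have h1 := hg.sum_tail (G.tail e)
  rw [zero_mul] at h1
  by_contra! hno
  have h2 := (Finset.sum_eq_zero_iff_of_nonneg
    (fun d hd => by
      have := hno (G.rev d) (by simpa using hd)
      rw [hg.antisymm] at this
      linarith)).1 h1 e (by simp)
  linarith

/-- The potential of a simple path is nonnegative. -/
theorem nonneg_of_isSimplePath {x y : D} (hx : G.left x = G.infFace)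
    (hy : G.left y = G.infFace) (hne : x ≠ y) {R : List D}
    (hR : IsSimplePath G.tail G.head (G.tail x) R (G.tail y)) {ψ : SplitFace G.Face → ℝ}
    (ha : ψ SplitFace.a = 0) (hb : ψ SplitFace.b = 1)
    (hψ : ∀ d, G.walkFlow R d = ψ (G.splitRight x y d) - ψ (G.splitLeft x y d)) (d : D) :
    0 ≤ ψ (G.splitLeft x y d) := by
  classical
  by_contra! hd
  have : Nonempty D := ⟨d⟩
  obtain ⟨d₀, hmin⟩ := Finite.exists_min fun d => ψ (G.splitLeft x y d)
  set r := ψ (G.splitLeft x y d₀) with hr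
  have hr0 : r < 0 := (hmin d).trans_lt hd
  -- The coboundary of χ is a circulation, as neither a nor b attains the negative minimum `r`. Its
  -- positive darts leave the minimum level and so belong to `R`; each has a positive predecessor,
  -- earlier on `R` because `R` is simple. This descent cannot go on forever.
  let χ : SplitFace G.Face → ℝ := fun p => if ψ p = r then 0 else 1
  have hχa : χ SplitFace.a = 1 := if_neg (by rw [ha]; exact hr0.ne')
  have hχb : χ SplitFace.b = 1 := if_neg (by rw [hb]; linarith)
  have hflow := G.isFlowOfValue_splitCoboundary hx hy hne χ
  rw [hχa, hχb, sub_self] at hflow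
  have hpos : ∀ e, 0 < χ (G.splitRight x y e) - χ (G.splitLeft x y e) →
      ψ (G.splitLeft x y e) = r ∧ ψ (G.splitRight x y e) ≠ r := by
    intro e he
    by_cases h1 : ψ (G.splitLeft x y e) = r <;> by_cases h2 : ψ (G.splitRight x y e) = r <;>
      simp [χ, h1, h2] at he ⊢
    linarith
  have hmem : ∀ e, 0 < χ (G.splitRight x y e) - χ (G.splitLeft x y e) → e ∈ R := by
    intro e he
    obtain ⟨h1, h2⟩ := hpos e he
    apply G.mem_of_walkFlow_pos
    rw [hψ, h1, sub_pos]
    exact lt_of_le_of_ne (hmin (G.rev e)) (Ne.symm h2)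
  have hnone : ∀ n, ∀ P Q e, P.length = n → R = P ++ e :: Q →
      ¬ 0 < χ (G.splitRight x y e) - χ (G.splitLeft x y e) := by
    intro n
    induction n using Nat.strong_induction_on with
    | _ n ih =>
      intro P Q e hn hPQ he
      obtain ⟨e', h1, h2⟩ := hflow.exists_prev he
      have h3 := hmem e' h2
      rw [hPQ] at h3 hR
      obtain ⟨P', Q', rfl⟩ := List.append_of_mem (hR.mem_prefix h3 h1)
      refine ih P'.length ?_ P' (Q' ++ e :: Q) e' rfl (by simp [hPQ]) h2
      rw [← hn]
      simp
  -- Otherwise the minimum would spread over the connected dual to the infinite face, where ψ is 0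
  -- or 1.
  have hex : ∃ e, ψ (G.splitLeft x y e) = r ∧ ψ (G.splitRight x y e) ≠ r := by
    by_contra! hno
    have h1 : ψ (G.splitLeft x y G.outer) = r :=
      G.dart_induction_faceNext (p := fun e => ψ (G.splitLeft x y e) = r) (d := d₀)
        (fun e he => by
          by_cases h : G.left e = G.infFace
          · rw [splitLeft] at he
            split_ifs at he <;> linarith
          · rw [splitLeft_of_left_ne _ hx h] at he
            rw [splitLeft_of_left_ne _ hx (by simpa using h), left_faceNext, he])
        (fun e he => hno e he) rfl _
    have h2 : G.left G.outer = G.infFace := rfl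
    rw [splitLeft] at h1
    split_ifs at h1 <;> linarith
  obtain ⟨e, h1, h2⟩ := hex
  have he : 0 < χ (G.splitRight x y e) - χ (G.splitLeft x y e) := by simp [χ, h1, h2]
  obtain ⟨P, Q, hPQ⟩ := List.append_of_mem (hmem e he)
  exact hnone _ P Q e rfl hPQ he

/-! ### Simple cycles and clockwise acyclicity -/

theorem walkFlow_eq_zero {P : List D} {d : D} (h : d ∉ P) (h' : G.rev d ∉ P) :
    G.walkFlow P d = 0 := by
  classical
  rw [walkFlow, List.count_eq_zero_of_not_mem h, List.count_eq_zero_of_not_mem h', sub_self]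

/-- Among darts that can always be continued there is a simple cycle. -/
theorem exists_isSimpleCycle {E : D → Prop} {e : D} (he : E e)
    (hnext : ∀ e, E e → ∃ e', G.tail e' = G.head e ∧ E e') :
    ∃ Z, G.IsSimpleCycle Z ∧ ∀ d ∈ Z, E d := by
  classical
  let S : Set G.Vertex := {v | ∃ e, G.tail e = v ∧ E e}
  have hout : ∀ v : S, ∃ e, G.tail e = v ∧ E e := fun v => v.2
  choose out htail hE using hout
  let σ : S → S := fun v => ⟨G.head (out v), hnext _ (hE v)⟩
  let v₀ : S := ⟨G.tail e, e, rfl, he⟩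
  obtain ⟨a, b, hab, h⟩ := Finite.exists_ne_map_eq_of_infinite fun n : ℕ => σ^[n] v₀
  have hper : ∃ v : S, v ∈ Function.periodicPts σ := by
    wlog hlt : a < b generalizing a b
    · exact this b a hab.symm h.symm (lt_of_le_of_ne (not_lt.1 hlt) hab.symm)
    refine ⟨σ^[a] v₀, Function.mk_mem_periodicPts (Nat.sub_pos_of_lt hlt) ?_⟩
    change σ^[b - a] (σ^[a] v₀) = σ^[a] v₀
    rw [← Function.iterate_add_apply, Nat.sub_add_cancel hlt.le]
    exact h.symm
  obtain ⟨v, hv⟩ := hper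
  have hwalk : ∀ n : ℕ, IsWalk G.tail G.head v.1
      ((List.range n).map fun k => out (σ^[k] v)) (σ^[n] v).1 := by
    intro n
    induction n with
    | zero => simp [IsWalk]
    | succ n ih =>
      rw [List.range_succ, List.map_append]
      refine isWalk_append_iff.2 ⟨_, ih, htail _, ?_⟩
      rw [Function.iterate_succ_apply']
      rfl
  refine ⟨(List.range (Function.minimalPeriod σ v)).map fun k => out (σ^[k] v),
    ⟨?_, ⟨v.1, ?_⟩, ?_⟩, ?_⟩
  · simpa using (Function.minimalPeriod_pos_of_mem_periodicPts hv).ne'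
  · have := hwalk (Function.minimalPeriod σ v)
    rwa [Function.iterate_minimalPeriod] at this
  · rw [List.map_map]
    refine List.Nodup.map_on (fun a ha b hb hab => ?_) List.nodup_range
    rw [List.mem_range] at ha hb
    have h1 : σ^[a] (σ v) = σ^[b] (σ v) := by
      rw [← Function.iterate_succ_apply, ← Function.iterate_succ_apply,
        Function.iterate_succ_apply', Function.iterate_succ_apply']
      exact Subtype.ext hab
    have h2 := Function.minimalPeriod_apply hv
    exact Function.iterate_injOn_Iio_minimalPeriod (f := σ) (x := σ v)
      (by rw [h2]; exact ha) (by rw [h2]; exact hb) h1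
  · intro d hd
    obtain ⟨k, -, rfl⟩ := List.mem_map.1 hd
    exact hE _

/-- If no clockwise cycle is residual, then every face is reached from the infinite face through
nonresidual darts. -/
theorem ClockwiseAcyclic.reflTransGen {G : PlaneGraph D} {c : D → ℝ} (hc : G.ClockwiseAcyclic c)
    (F : G.Face) : Relation.ReflTransGen
      (fun y z => ∃ d, G.left d = y ∧ G.right d = z ∧ c d ≤ 0) G.infFace F := by
  classical
  set U : Set G.Face := {F | Relation.ReflTransGen
      (fun y z => ∃ d, G.left d = y ∧ G.right d = z ∧ c d ≤ 0) G.infFace F} with hU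
  by_contra hF
  have hex : ∃ e, G.left e ∈ U ∧ G.right e ∉ U := by
    by_contra! hno
    obtain ⟨d, rfl⟩ := G.exists_left F
    exact hF (G.dart_induction_faceNext (p := fun e => G.left e ∈ U) (d := G.outer)
      (fun e he => by simpa using he) hno Relation.ReflTransGen.refl d)
  let φ : G.Face → ℝ := fun F => if F ∈ U then 0 else 1
  have hpos : ∀ e, 0 < φ (G.right e) - φ (G.left e) ↔ G.left e ∈ U ∧ G.right e ∉ U := by
    intro e
    by_cases h1 : G.left e ∈ U <;> by_cases h2 : G.right e ∈ U <;> simp [φ, h1, h2]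
  have hflow : G.IsFlowOfValue (fun d => φ (G.right d) - φ (G.left d)) (G.tail G.outer)
      (G.tail G.outer) 0 :=
    ⟨fun d => by simp, fun h => by rw [sum_tail_mul_coboundary]; simp⟩
  obtain ⟨e, he⟩ := hex
  -- The darts leaving `U` are residual and can always be continued, so they contain a simple cycle.
  -- Its potential ψ is constant outside the cycle and larger on its right, which makes the cycle
  -- clockwise.
  obtain ⟨Z, hZ, hE⟩ := G.exists_isSimpleCycle (E := fun e => G.left e ∈ U ∧ G.right e ∉ U) he
    (fun e he => by
      obtain ⟨e', h1, h2⟩ := hflow.exists_next ((hpos e).2 he)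
      exact ⟨e', h1, (hpos e').1 h2⟩)
  obtain ⟨u, hwalk⟩ := hZ.2.1
  have hZflow := G.walkFlow_isFlowOfValue hwalk
  obtain ⟨ψ, hψ⟩ := G.exists_potential hZflow.antisymm
    fun h => by rw [hZflow.sum_mul, sub_self, mul_zero]
  have hconst : ∀ {d}, d ∉ Z → G.rev d ∉ Z → ψ (G.right d) = ψ (G.left d) := by
    intro d h1 h2
    have := hψ d
    rw [G.walkFlow_eq_zero h1 h2] at this
    linarith
  have hin : ∀ F ∈ U, ψ F = ψ G.infFace := by
    intro F hF
    induction hF with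
    | refl => rfl
    | tail h1 h2 ih =>
      have h3 := h1.tail h2
      obtain ⟨d, rfl, rfl, -⟩ := h2
      rw [← ih]
      refine hconst (fun hd => (hE d hd).2 h3) fun hd => ?_
      have := (hE _ hd).2
      rw [right_rev] at this
      exact this h1
  refine hc Z ⟨hZ, fun d hd hout => ?_⟩ fun d hd => ?_
  · have h1 : ∀ F, G.OutsideFace Z F → ψ F = ψ G.infFace := by
      intro F hF
      induction hF with
      | refl => rfl
      | tail _ h2 ih =>
        obtain ⟨d, rfl, rfl, h3, h4⟩ := h2
        rw [← ih, hconst h3 h4]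
    have h2 := G.walkFlow_pos hd fun h => (hE d hd).2 (hE _ h).1
    rw [hψ, h1 _ hout, hin _ (hE d hd).1] at h2
    linarith
  · by_contra! hle
    exact (hE d hd).2 ((show G.left d ∈ U from (hE d hd).1).tail ⟨d, rfl, rfl, hle⟩)

/-! ### Maximum flows, closed vertex sets and cuts -/

theorem walkFlow_le_length (P : List D) (d : D) : G.walkFlow P d ≤ P.length := by
  classical
  have h1 : ((P.count d : ℕ) : ℝ) ≤ P.length := by exact_mod_cast List.count_le_length
  have h2 : (0 : ℝ) ≤ P.count (G.rev d) := Nat.cast_nonneg _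
  rw [walkFlow]
  linarith

/-- After a maximum flow there is no augmenting path. -/
theorem IsLeftmostMaxFlow.not_isResidual {G : PlaneGraph D} {c f : D → ℝ} {x y : G.Vertex}
    (hxy : x ≠ y) (hf : G.IsLeftmostMaxFlow c x y f) {P : List D}
    (hP : IsWalk G.tail G.head x P y) : ¬ IsResidual (fun d => c d - f d) P := by
  intro hres
  obtain ⟨r, hr, hle⟩ := exists_pos_le_of_isResidual hres
  have hlen : (0 : ℝ) < P.length + 1 := by positivity
  -- A walk may use a dart up to `P.length` times; the `+ 1` avoids division by zero.
  have hε : 0 < r / (P.length + 1) := div_pos hr hlen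
  have hg := (hf.flow.isFlowOfValue hxy).add_smul (G.walkFlow_isFlowOfValue hP)
    (r / (P.length + 1))
  have h1 := hf.maximum _ (hg.isFlow (c := c) fun d => by
    by_cases hd : 0 < G.walkFlow P d
    · have h2 := hle d (G.mem_of_walkFlow_pos hd)
      have h3 := G.walkFlow_le_length P d
      have h4 : r / (P.length + 1) * G.walkFlow P d ≤ r / (P.length + 1) * (P.length + 1) :=
        mul_le_mul_of_nonneg_left (by linarith) hε.le
      rw [div_mul_cancel₀ _ hlen.ne'] at h4
      linarith
    · have h2 := mul_nonpos_of_nonneg_of_nonpos hε.le (not_lt.1 hd)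
      have h3 := hf.flow.le_cap d
      linarith)
  rw [hg.inflow_eq hxy] at h1
  linarith

theorem IsLeftmostMaxFlow.inflow_nonneg {G : PlaneGraph D} {c f : D → ℝ} {x y : G.Vertex}
    (hc : ∀ d, 0 ≤ c d) (hf : G.IsLeftmostMaxFlow c x y f) : 0 ≤ G.inflow f y := by
  have h := hf.maximum (fun _ => 0) ⟨by simp, hc, by simp⟩
  simpa [inflow] using h

/-- A set of vertices that no residual dart leaves keeps this property when flow is pushed. -/
theorem IsFlowOfValue.closed_sub {G : PlaneGraph D} {c f : D → ℝ} {x y : G.Vertex} {v : ℝ}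
    (hf : G.IsFlowOfValue f x y v) (hv : 0 ≤ v) (hcap : ∀ d, f d ≤ c d) {S : Set G.Vertex}
    (hS : ∀ d, G.tail d ∈ S → 0 < c d → G.head d ∈ S) (hxy : y ∈ S → x ∈ S) (d : D)
    (hd : G.tail d ∈ S) (hpos : 0 < c d - f d) : G.head d ∈ S := by
  classical
  by_contra hd'
  have h1 := hf.sum_leaving S
  have hterm : ∀ e ∈ Finset.univ, (if G.tail e ∈ S ∧ G.head e ∉ S then f e else 0) ≤ 0 := by
    intro e _
    split_ifs with he
    · have h2 : ¬ 0 < c e := fun h => he.2 (hS e he.1 h)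
      linarith [hcap e]
    · exact le_rfl
  -- The net flow out of `S` is nonnegative while every leaving dart carries at most 0, so `f`
  -- vanishes on all of them.
  have h2 : 0 ≤ v * ((if x ∈ S then 1 else 0) - if y ∈ S then 1 else 0) := by
    refine mul_nonneg hv ?_
    by_cases hy : y ∈ S
    · simp [hy, hxy hy]
    · simp only [hy, if_false, sub_zero]
      split_ifs <;> norm_num
  have h3 := (Finset.sum_eq_zero_iff_of_nonpos hterm).1
    (le_antisymm (Finset.sum_nonpos hterm) (h1 ▸ h2)) d (Finset.mem_univ d)
  rw [if_pos ⟨hd, hd'⟩] at h3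
  exact hd' (hS d hd (by linarith))

theorem closed_of_isWalk {c : D → ℝ} {S : Set G.Vertex}
    (hS : ∀ d, G.tail d ∈ S → 0 < c d → G.head d ∈ S) {u w : G.Vertex} {P : List D}
    (hP : IsWalk G.tail G.head u P w) (hres : IsResidual c P) (hu : u ∈ S) : w ∈ S := by
  induction P generalizing u with
  | nil => rwa [← (hP : u = w)]
  | cons d P ih =>
    obtain ⟨rfl, h2⟩ := hP
    exact ih h2 (fun e he => hres e (by simp [he])) (hS d hu (hres d (by simp)))

theorem reflTransGen_faceNext {Q : D → Prop} {d : D} {n : ℕ}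
    (hQ : ∀ k < n, Q ((G.faceNext ^ k) d)) :
    Relation.ReflTransGen (fun u w => ∃ e, G.tail e = u ∧ G.head e = w ∧ Q e) (G.tail d)
      (G.tail ((G.faceNext ^ n) d)) := by
  refine (G.isWalk_faceNext d n).reflTransGen fun e he => ?_
  obtain ⟨k, hk, rfl⟩ := List.mem_map.1 he
  exact hQ k (List.mem_range.1 hk)

/-- The tails of the darts of a simple cut are connected to `x` by paths that do not cross the
cut. -/
theorem reflTransGen_tail_of_mem_cut {x y : D} (hx : G.left x = G.infFace) {C : List D}
    (hC : IsSimplePath (G.splitLeft x y) (G.splitRight x y) SplitFace.a C SplitFace.b) {d : D}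
    (hd : d ∈ C) : Relation.ReflTransGen
      (fun u w => ∃ e, G.tail e = u ∧ G.head e = w ∧ e ∉ C ∧ G.rev e ∉ C) (G.tail x)
      (G.tail d) := by
  -- Induction along `C`: the tail of its first dart is reached along the boundary from `x`, each
  -- further tail by going round the face between two consecutive cut darts.
  obtain ⟨P, Q, hPQ⟩ := List.append_of_mem hd
  clear hd
  induction P using List.reverseRecOn generalizing d Q with
  | nil =>
    rw [List.nil_append] at hPQ
    have hsrc : G.splitLeft x y d = SplitFace.a := by
      have := hC.1
      rw [hPQ] at this
      exact this.1
    obtain ⟨n, rfl, hn⟩ := G.splitLeft_eq_a_iff.1 hsrc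
    obtain ⟨n', hn', hmin⟩ : ∃ n', (G.faceNext ^ n') x = (G.faceNext ^ n) x ∧
        ∀ k < n', (G.faceNext ^ k) x ≠ (G.faceNext ^ n) x := by
      classical
      have hex : ∃ n', (G.faceNext ^ n') x = (G.faceNext ^ n) x := ⟨n, rfl⟩
      exact ⟨Nat.find hex, Nat.find_spec hex, fun k hk => Nat.find_min hex hk⟩
    have hle : n' ≤ n := not_lt.1 fun h => hmin n h rfl
    rw [← hn']
    refine G.reflTransGen_faceNext (Q := fun e => e ∉ C ∧ G.rev e ∉ C) fun k hk => ?_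
    have hka : G.splitLeft x y ((G.faceNext ^ k) x) = SplitFace.a :=
      G.splitLeft_eq_a_iff.2 ⟨k, rfl, fun l hl => hn l (by omega)⟩
    constructor
    · intro hmem
      exact hmin k hk (hC.eq_of_src_eq hmem (hPQ ▸ List.mem_cons_self) (hka.trans hsrc.symm))
    · intro hmem
      have h1 := List.mem_map_of_mem (f := G.splitRight x y) hmem
      rw [splitRight, G.rev_rev, hka] at h1
      exact (List.nodup_cons.1 hC.2).1 h1
  | append_singleton P e ih =>
    have hPQ' : C = P ++ e :: d :: Q := by simpa using hPQ
    have hIH := ih _ hPQ'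
    have heC : e ∈ C := by simp [hPQ']
    have hdC : d ∈ C := by simp [hPQ']
    have hed : G.splitRight x y e = G.splitLeft x y d := by
      have h1 := hC.1
      rw [hPQ'] at h1
      obtain ⟨v, -, h2, h3, -⟩ := isWalk_append_iff.1 h1
      exact h3.symm
    have hlast : ∀ e' ∈ C, G.splitLeft x y e' ≠ SplitFace.b := by
      intro e' he' hb
      have h1 := hC.2
      rw [← hC.1.map_src_append, List.nodup_append] at h1
      exact h1.2.2 _ (List.mem_map_of_mem he') _ (List.mem_singleton_self _) hb
    have hna : G.splitLeft x y d ≠ SplitFace.a := by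
      intro h
      have h1 := List.mem_map_of_mem (f := G.splitRight x y) heC
      rw [hed, h] at h1
      exact (List.nodup_cons.1 hC.2).1 h1
    have hdF : G.left d ≠ G.infFace := by
      intro h
      by_cases h1 : d ∈ G.boundaryArc x y
      · exact hna (G.splitLeft_of_mem h1)
      · exact hlast d hdC (G.splitLeft_of_notMem h h1)
    have hsame : G.left (G.faceNext (G.rev e)) = G.left d := by
      rw [left_faceNext]
      rw [G.splitLeft_of_left_ne hx hdF, splitRight, splitLeft_eq_inner_iff _ hx] at hed
      exact hed.1
    obtain ⟨n, hn, hmin⟩ : ∃ n, (G.faceNext ^ n) (G.faceNext (G.rev e)) = d ∧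
        ∀ k < n, (G.faceNext ^ k) (G.faceNext (G.rev e)) ≠ d := by
      classical
      have hex : ∃ n : ℕ, (G.faceNext ^ n) (G.faceNext (G.rev e)) = d :=
        (G.left_eq_iff.1 hsame).exists_nat_pow_eq
      exact ⟨Nat.find hex, Nat.find_spec hex, fun k hk => Nat.find_min hex hk⟩
    refine hIH.trans ?_
    have h0 : G.tail e = G.tail (G.faceNext (G.rev e)) := by simp
    rw [h0]
    conv_rhs => rw [← hn]
    refine G.reflTransGen_faceNext (Q := fun e => e ∉ C ∧ G.rev e ∉ C) fun k hk => ?_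
    have hk1 : G.splitLeft x y ((G.faceNext ^ k) (G.faceNext (G.rev e))) = G.splitLeft x y d := by
      rw [G.splitLeft_of_left_ne hx hdF, G.splitLeft_of_left_ne hx] <;>
        rw [left_faceNext_pow, hsame]
      exact hdF
    constructor
    · intro hmem
      exact hmin k hk (hC.eq_of_src_eq hmem hdC hk1)
    · intro hmem
      have h1 : G.rev ((G.faceNext ^ k) (G.faceNext (G.rev e))) = e := by
        refine hC.eq_of_tgt_eq hmem heC ?_
        rw [hed, ← hk1, splitRight, G.rev_rev]
      have h2 : (G.faceNext ^ k) (G.faceNext (G.rev e)) = G.rev e := by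
        have := congrArg G.rev h1
        rwa [G.rev_rev] at this
      -- Meeting `rev e` again means that the face traversal has started over, so `d` would have
      -- been reached sooner.
      refine hmin (n - (k + 1)) (by omega) ?_
      conv_rhs => rw [← hn]
      have h3 : n = (n - (k + 1)) + 1 + k := by omega
      conv_rhs => rw [h3, pow_add, pow_succ, Equiv.Perm.mul_apply, h2, Equiv.Perm.mul_apply]

end PlaneGraph

/-! ### Terminals on the boundary walk and closed pairs -/

namespace Terminals

variable {D : Type*} [Fintype D] {G : PlaneGraph D} {m : ℕ} (K : Terminals G m)

theorem source_ne_sink (i j : Fin m) : K.source i ≠ K.sink j := fun h =>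
  Sum.inl_ne_inr (K.distinct (a₁ := Sum.inl i) (a₂ := Sum.inr j) h)

theorem s_ne_t (i j : Fin m) : K.s i ≠ K.t j := fun h =>
  K.source_ne_sink i j (congrArg G.tail h)

theorem left_s (i : Fin m) : G.left (K.s i) = G.infFace := by
  obtain ⟨r, p, q, hr, hst, -⟩ := K.clockwise
  rw [(hst i).1, G.left_faceNext_pow, hr]

theorem left_t (i : Fin m) : G.left (K.t i) = G.infFace := by
  obtain ⟨r, p, q, hr, hst, -⟩ := K.clockwise
  rw [(hst i).2.1, G.left_faceNext_pow, hr]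

end Terminals

namespace PlaneGraph

variable {D : Type*} [Fintype D] (G : PlaneGraph D)

theorem faceNext_pow_inj {r : D} {a b : ℕ} (ha : a < Function.minimalPeriod G.faceNext r)
    (hb : b < Function.minimalPeriod G.faceNext r) :
    (G.faceNext ^ a) r = (G.faceNext ^ b) r ↔ a = b := by
  refine ⟨fun h => ?_, fun h => by rw [h]⟩
  rw [← Equiv.Perm.iterate_eq_pow, ← Equiv.Perm.iterate_eq_pow] at h
  exact Function.iterate_injOn_Iio_minimalPeriod ha hb h

theorem faceNext_pow_minimalPeriod_add (r : D) (a : ℕ) :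
    (G.faceNext ^ (Function.minimalPeriod G.faceNext r + a)) r = (G.faceNext ^ a) r := by
  rw [← Equiv.Perm.iterate_eq_pow, ← Equiv.Perm.iterate_eq_pow, Nat.add_comm,
    Function.iterate_add_minimalPeriod_eq]

/-- The part of the boundary between two darts in terms of positions on the boundary walk. -/
theorem mem_boundaryArc_pow_iff {r : D} {a b n : ℕ}
    (ha : a < Function.minimalPeriod G.faceNext r) (hb : b < Function.minimalPeriod G.faceNext r)
    (hn : n < Function.minimalPeriod G.faceNext r) (hab : a ≠ b) :
    (G.faceNext ^ n) r ∈ G.boundaryArc ((G.faceNext ^ a) r) ((G.faceNext ^ b) r) ↔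
      (a < b ∧ a ≤ n ∧ n < b) ∨ (b < a ∧ (a ≤ n ∨ n < b)) := by
  set M := Function.minimalPeriod G.faceNext r with hM
  have hadd : ∀ k : ℕ, (G.faceNext ^ k) ((G.faceNext ^ a) r) = (G.faceNext ^ (k + a)) r :=
    fun k => by rw [pow_add, Equiv.Perm.mul_apply]
  have hwrap : ∀ k : ℕ, M ≤ k → (G.faceNext ^ k) r = (G.faceNext ^ (k - M)) r := fun k hk => by
    rw [← G.faceNext_pow_minimalPeriod_add r (k - M), ← hM, Nat.add_sub_cancel' hk]
  simp only [boundaryArc, Set.mem_ofPred_eq, hadd]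
  constructor
  · rintro ⟨k, hk, hne⟩
    rcases lt_or_gt_of_ne hab with h | h
    · have h1 : k < b - a := by
        by_contra h1
        exact hne (b - a) (not_lt.1 h1) (by rw [Nat.sub_add_cancel h.le])
      have h2 := (G.faceNext_pow_inj hn (by omega)).1 hk
      omega
    -- For `b < a` the arc wraps around and has `M + b - a` darts.
    · have h1 : k < M + b - a := by
        by_contra h1
        refine hne (M + b - a) (not_lt.1 h1) ?_
        rw [Nat.sub_add_cancel (by omega), hM, G.faceNext_pow_minimalPeriod_add]
      by_cases h2 : k + a < M
      · have h3 := (G.faceNext_pow_inj hn h2).1 hk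
        omega
      · rw [hwrap _ (not_lt.1 h2)] at hk
        have h3 := (G.faceNext_pow_inj hn (by omega)).1 hk
        omega
  · rintro (⟨h, h1, h2⟩ | ⟨h, h1 | h1⟩)
    · refine ⟨n - a, by rw [Nat.sub_add_cancel h1], fun l hl he => ?_⟩
      have := (G.faceNext_pow_inj (by omega) hb).1 he
      omega
    · refine ⟨n - a, by rw [Nat.sub_add_cancel h1], fun l hl he => ?_⟩
      have := (G.faceNext_pow_inj (by omega) hb).1 he
      omega
    · refine ⟨M + n - a, ?_, fun l hl he => ?_⟩
      · rw [Nat.sub_add_cancel (by omega), hM, G.faceNext_pow_minimalPeriod_add]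
      · by_cases h2 : l + a < M
        · have := (G.faceNext_pow_inj h2 hb).1 he
          omega
        · rw [hwrap _ (not_lt.1 h2)] at he
          have := (G.faceNext_pow_inj (by omega) hb).1 he
          omega

theorem exists_pow_of_left_eq {r d : D} (h : G.left r = G.left d) :
    ∃ n < Function.minimalPeriod G.faceNext r, d = (G.faceNext ^ n) r := by
  obtain ⟨n, hn⟩ := (G.left_eq_iff.1 h).exists_nat_pow_eq
  have hpos : 0 < Function.minimalPeriod G.faceNext r :=
    Function.minimalPeriod_pos_of_mem_periodicPts
      (G.faceNext.injective.mem_periodicPts r)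
  refine ⟨n % Function.minimalPeriod G.faceNext r, Nat.mod_lt _ hpos, ?_⟩
  rw [← hn, ← Equiv.Perm.iterate_eq_pow, ← Equiv.Perm.iterate_eq_pow,
    Function.iterate_mod_minimalPeriod_eq]

end PlaneGraph

namespace Terminals

variable {D : Type*} [Fintype D] {G : PlaneGraph D} {m : ℕ} (K : Terminals G m)

/-- Positions on the boundary walk describe all boundary parts between terminals. -/
theorem exists_position : ∃ (p q : Fin m → ℕ), (∀ i, p i < q i) ∧ (∀ i j, i < j → q i < p j) ∧
    ∀ d, G.left d = G.infFace → ∃ n : ℕ, ∀ i j, d ∈ G.boundaryArc (K.s i) (K.t j) ↔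
      (p i < q j ∧ p i ≤ n ∧ n < q j) ∨ (q j < p i ∧ (p i ≤ n ∨ n < q j)) := by
  obtain ⟨r, p, q, hr, hst, hlt⟩ := K.clockwise
  refine ⟨p, q, fun i => (hst i).2.2.1, hlt, fun d hd => ?_⟩
  obtain ⟨n, hn, rfl⟩ := G.exists_pow_of_left_eq (hr.trans hd.symm)
  refine ⟨n, fun i j => ?_⟩
  have h1 := hst i
  have h2 := hst j
  rw [h1.1, h2.2.1]
  refine G.mem_boundaryArc_pow_iff (by omega) (by omega) hn fun h => K.s_ne_t i j ?_
  rw [h1.1, h2.2.1, h]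

theorem boundaryArc_subset {i j k l : Fin m} (hki : k ≤ i) (hij : i ≤ j) (hjl : j ≤ l) :
    G.boundaryArc (K.s i) (K.t j) ⊆ G.boundaryArc (K.s k) (K.t l) := by
  obtain ⟨p, q, hpq, hqp, hpos⟩ := K.exists_position
  intro d hd
  obtain ⟨n, hn⟩ := hpos d ((G.left_of_mem_boundaryArc hd).trans (K.left_s i))
  rw [hn] at hd ⊢
  have h1 := hpq i
  have h2 := hpq j
  have h3 := hpq k
  have h4 := hpq l
  rcases hki.eq_or_lt with rfl | h5 <;> rcases hij.eq_or_lt with rfl | h6 <;>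
    rcases hjl.eq_or_lt with rfl | h7 <;> (try have := hqp _ _ h5) <;>
    (try have := hqp _ _ h6) <;> (try have := hqp _ _ h7) <;> omega

/-- For `k > j` the arc from `s k` to `t j` wraps around and omits only the boundary from `t j` to
`s k`. -/
theorem boundaryArc_subset_of_lt {i j k : Fin m} (hij : i ≤ j) (hjk : j < k) :
    G.boundaryArc (K.s i) (K.t j) ⊆ G.boundaryArc (K.s k) (K.t j) := by
  obtain ⟨p, q, hpq, hqp, hpos⟩ := K.exists_position
  intro d hd
  obtain ⟨n, hn⟩ := hpos d ((G.left_of_mem_boundaryArc hd).trans (K.left_s i))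
  rw [hn] at hd ⊢
  have h1 := hpq i
  have h2 := hpq j
  have h3 := hqp _ _ hjk
  rcases hij.eq_or_lt with rfl | h6 <;> (try have := hqp _ _ h6) <;> omega

theorem mem_boundaryArc_of_mem_of_mem {i j k l : Fin m} (hik : i ≤ k) (hkj : k ≤ j)
    (hjl : j ≤ l) {d : D} (hd : d ∈ G.boundaryArc (K.s i) (K.t j))
    (hd' : d ∈ G.boundaryArc (K.s k) (K.t l)) : d ∈ G.boundaryArc (K.s k) (K.t j) := by
  obtain ⟨p, q, hpq, hqp, hpos⟩ := K.exists_position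
  obtain ⟨n, hn⟩ := hpos d ((G.left_of_mem_boundaryArc hd).trans (K.left_s i))
  rw [hn] at hd hd' ⊢
  have h1 := hpq i
  have h2 := hpq j
  have h3 := hpq k
  have h4 := hpq l
  rcases hik.eq_or_lt with rfl | h5 <;> rcases hkj.eq_or_lt with rfl | h6 <;>
    rcases hjl.eq_or_lt with rfl | h7 <;> (try have := hqp _ _ h5) <;>
    (try have := hqp _ _ h6) <;> (try have := hqp _ _ h7) <;> omega

/-- Pushing a maximum flow from `s i` to `t j` closes the pair `(i, j)` and opens no pair that was
closed by the preprocessing or by an earlier iteration. -/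
theorem not_isResidual_sub {i j : Fin m} {c f : D → ℝ} (hc : ∀ d, 0 ≤ c d)
    (hno : ∀ k l : Fin m, l < k ∨ l < j ∨ (l = j ∧ i < k) →
      ∀ P, IsWalk G.tail G.head (K.source k) P (K.sink l) → ¬ IsResidual c P)
    (hf : G.IsLeftmostMaxFlow c (K.source i) (K.sink j) f) (k l : Fin m)
    (hkl : l < k ∨ l < j ∨ (l = j ∧ i ≤ k)) (P : List D)
    (hP : IsWalk G.tail G.head (K.source k) P (K.sink l)) :
    ¬ IsResidual (fun d => c d - f d) P := by
  intro hres
  by_cases hij : k = i ∧ l = j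
  · obtain ⟨rfl, rfl⟩ := hij
    exact hf.not_isResidual (K.source_ne_sink _ _) hP hres
  have hkl' : l < k ∨ l < j ∨ (l = j ∧ i < k) := by
    rcases hkl with h | h | ⟨h, h'⟩
    · exact Or.inl h
    · exact Or.inr (Or.inl h)
    · exact Or.inr (Or.inr ⟨h, lt_of_le_of_ne h' fun h'' => hij ⟨h''.symm, h⟩⟩)
  have hflow := hf.flow.isFlowOfValue (K.source_ne_sink i j)
  have hv := hf.inflow_nonneg hc
  -- Opening (k, l) requires earlier residual paths from `s k` to `t j` and from `s i` to `t l`: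
  -- without one of them, a closed set separates `s k` from `l` and stays closed. With both, k < i ≤
  -- l and j < l, so (k, l) was not among the closed pairs.
  by_cases h1 : ∃ Q, IsWalk G.tail G.head (K.source k) Q (K.sink j) ∧ IsResidual c Q
  · by_cases h2 : ∃ Q, IsWalk G.tail G.head (K.source i) Q (K.sink l) ∧ IsResidual c Q
    · obtain ⟨Q₁, hQ₁, hr₁⟩ := h1
      obtain ⟨Q₂, hQ₂, hr₂⟩ := h2
      have hkj : ¬ (j < k ∨ j < j ∨ (j = j ∧ i < k)) := fun h => hno _ _ h _ hQ₁ hr₁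
      have hil : ¬ (l < i ∨ l < j ∨ (l = j ∧ i < i)) := fun h => hno _ _ h _ hQ₂ hr₂
      have hki : k ≠ i := fun h => hno _ _ hkl' Q₂ (h ▸ hQ₂) hr₂
      have hlj : l ≠ j := fun h => hno _ _ hkl' Q₁ (h ▸ hQ₁) hr₁
      omega
    · refine G.closed_of_isWalk (S := {v | ¬ ∃ Q, IsWalk G.tail G.head v Q (K.sink l) ∧
        IsResidual c Q}) (hflow.closed_sub hv hf.flow.le_cap ?_ fun _ => h2) hP hres ?_ ?_
      · rintro d hd hpos ⟨Q, hQ, hr⟩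
        refine hd ⟨d :: Q, ⟨rfl, hQ⟩, fun e he => ?_⟩
        rcases List.mem_cons.1 he with rfl | he
        exacts [hpos, hr e he]
      · rintro ⟨Q, hQ, hr⟩
        exact hno _ _ hkl' Q hQ hr
      · exact ⟨[], rfl, fun e he => absurd he List.not_mem_nil⟩
  · have h2 := G.closed_of_isWalk (S := {v | ∃ Q, IsWalk G.tail G.head (K.source k) Q v ∧
        IsResidual c Q}) (hflow.closed_sub hv hf.flow.le_cap ?_ fun h => absurd h h1) hP hres
        ⟨[], rfl, fun e he => absurd he List.not_mem_nil⟩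
    · obtain ⟨Q, hQ, hr⟩ := h2
      exact hno _ _ hkl' Q hQ hr
    · rintro d ⟨Q, hQ, hr⟩ hpos
      refine ⟨Q ++ [d], isWalk_append_iff.2 ⟨_, hQ, isWalk_singleton d⟩, fun e he => ?_⟩
      rcases List.mem_append.1 he with he | he
      · exact hr e he
      · rwa [List.mem_singleton.1 he]

/-- The pairs that are closed at the start of an iteration. -/
theorem IterationStart.not_isResidual {K : Terminals G m} {c c' : D → ℝ} {i j : Fin m}
    (h : K.IterationStart c i j c') : (∀ d, 0 ≤ c' d) ∧ i ≤ j ∧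
      ∀ k l : Fin m, l < k ∨ l < j ∨ (l = j ∧ i < k) →
        ∀ P, IsWalk G.tail G.head (K.source k) P (K.sink l) → ¬ IsResidual c' P := by
  induction h with
  | first hz h =>
    obtain ⟨f, hf, hc₀⟩ := h.of_flow
    refine ⟨fun d => by rw [hc₀]; linarith [hf.le_cap d], le_rfl, fun k l hkl => ?_⟩
    exact h.no_path l k (by omega)
  | inner hk h hf ih =>
    obtain ⟨h1, h2, h3⟩ := ih
    refine ⟨fun d => sub_nonneg.2 (hf.flow.le_cap d), by omega, fun k l hkl => ?_⟩
    exact K.not_isResidual_sub h1 h3 hf k l (by omega)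
  | next hz hj h hf ih =>
    obtain ⟨h1, h2, h3⟩ := ih
    refine ⟨fun d => sub_nonneg.2 (hf.flow.le_cap d), le_rfl, fun k l hkl => ?_⟩
    exact K.not_isResidual_sub h1 h3 hf k l (by omega)

end Terminals

/-! ### Comparing split duals, and the potential of the maximum flow -/

namespace PlaneGraph

variable {D : Type*} [Fintype D] (G : PlaneGraph D)

/-- Two splits differ only at the infinite face, and enlarging the arc can only turn b into a. -/
theorem splitLeft_congr {x y x' y' d : D} (hx : G.left x = G.infFace)
    (hx' : G.left x' = G.infFace) (hsub : G.boundaryArc x y ⊆ G.boundaryArc x' y')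
    (hd : G.splitLeft x y d ≠ SplitFace.b) : G.splitLeft x' y' d = G.splitLeft x y d := by
  by_cases h : G.left d = G.infFace
  · by_cases h1 : d ∈ G.boundaryArc x y
    · rw [G.splitLeft_of_mem h1, G.splitLeft_of_mem (hsub h1)]
    · exact absurd (G.splitLeft_of_notMem h h1) hd
  · rw [G.splitLeft_of_left_ne hx h, G.splitLeft_of_left_ne hx' h]

/-- A simple path from `a` to `b` in the split dual is a path in every other split dual. -/
theorem exists_isWalk_split {x y x' y' : D} (hx : G.left x = G.infFace)
    (hx' : G.left x' = G.infFace) {Z : List D} {e : D} {p : SplitFace G.Face}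
    (hZ : IsWalk (G.splitLeft x y) (G.splitRight x y) p (e :: Z) SplitFace.b)
    (hnd : (SplitFace.a :: (e :: Z).map (G.splitRight x y)).Nodup) :
    ∃ e' ∈ e :: Z, G.splitRight x y e' = SplitFace.b ∧
      IsWalk (G.splitLeft x' y') (G.splitRight x' y') (G.splitLeft x' y' e) (e :: Z)
        (G.splitRight x' y' e') ∧
      (G.splitRight x' y' e' = SplitFace.b →
        (e :: Z).map (G.splitRight x' y') = (e :: Z).map (G.splitRight x y)) := by
  induction Z generalizing e p with
  | nil =>
    have h1 : G.splitRight x y e = SplitFace.b := hZ.2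
    refine ⟨e, List.mem_singleton_self _, h1, isWalk_singleton e, fun h2 => ?_⟩
    simp [h1, h2]
  | cons e₂ Z ih =>
    obtain ⟨-, h2, h3⟩ := hZ
    have hnd' : (SplitFace.a :: (e₂ :: Z).map (G.splitRight x y)).Nodup :=
      hnd.sublist (by simp)
    obtain ⟨e', he', hb, hw, heq⟩ := ih (p := G.splitLeft x y e₂) ⟨rfl, h3⟩ hnd'
    -- The path starts at a and reaches b only later, so by simplicity the face after `e` is inner,
    -- and inner faces are the same in both splits.
    have h4 := (List.nodup_cons.1 (List.nodup_cons.1 hnd).2).1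
    have hnb : G.splitRight x y e ≠ SplitFace.b := fun h =>
      h4 (h ▸ hb ▸ List.mem_map_of_mem he')
    have hna : G.splitRight x y e ≠ SplitFace.a := fun h =>
      (List.nodup_cons.1 hnd).1 (by simp [← h])
    have hl : G.left (G.rev e) ≠ G.infFace := by
      intro h
      by_cases h5 : G.rev e ∈ G.boundaryArc x y
      · exact hna (G.splitLeft_of_mem h5)
      · exact hnb (G.splitLeft_of_notMem h h5)
    have h6 : G.splitRight x y e = SplitFace.inner (G.left (G.rev e)) :=
      G.splitLeft_of_left_ne hx hl
    have h7 : G.splitRight x' y' e = SplitFace.inner (G.left (G.rev e)) :=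
      G.splitLeft_of_left_ne hx' hl
    have h8 : G.splitLeft x' y' e₂ = G.splitRight x' y' e := by
      rw [h6, G.splitLeft_eq_inner_iff hx] at h2
      rw [h7, G.splitLeft_eq_inner_iff hx']
      exact h2
    refine ⟨e', List.mem_cons_of_mem _ he', hb, ⟨rfl, ?_⟩, fun h => ?_⟩
    · rw [← h8]
      exact hw
    · rw [List.map_cons, heq h, h7, ← h6, ← List.map_cons]

variable {G}

/-- The potential `φ` of the flow `f` in the split dual, together with the facts on `f` and `c`
used below. -/
structure IsPotential (c f : D → ℝ) (x y : D) (v : ℝ) (φ : SplitFace G.Face → ℝ) : Prop where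
  a : φ SplitFace.a = 0
  b : φ SplitFace.b = v
  eq : ∀ d, f d = φ (G.splitRight x y d) - φ (G.splitLeft x y d)
  nonneg : ∀ d, 0 ≤ c d
  le_cap : ∀ d, f d ≤ c d

namespace IsPotential

variable {c f : D → ℝ} {x y : D} {v : ℝ} {φ : SplitFace G.Face → ℝ}

/-- `f` telescopes along a dual path; thus `c - f` are reduced lengths, nonnegative on every dart.
-/
theorem length_sub (hφ : IsPotential c f x y v φ) {Z : List D} {p q : SplitFace G.Face}
    (hZ : G.IsSplitPath x y p Z q) :
    length (fun d => c d - f d) Z = length c Z - (φ q - φ p) := by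
  have h1 : length (fun d => c d - f d) Z = length c Z - (Z.map f).sum := by
    clear hZ
    induction Z with
    | nil => simp [length]
    | cons d Z ih =>
      simp only [length, List.map_cons, List.sum_cons] at ih ⊢
      rw [ih]
      ring
  rw [h1, ← sum_map_coboundary φ hZ, funext hφ.eq]

theorem le_of_tight (hφ : IsPotential c f x y v φ) {d : D} (hd : c d - f d ≤ 0) :
    φ (G.splitLeft x y d) ≤ φ (G.splitRight x y d) := by
  have h1 := hφ.eq d
  have h2 := hφ.nonneg d
  linarith

theorem le_of_isWalk (hφ : IsPotential c f x y v φ) {Z : List D} {p q : SplitFace G.Face}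
    (hZ : G.IsSplitPath x y p Z q) (htight : ∀ d ∈ Z, c d - f d ≤ 0) {d : D} (hd : d ∈ Z) :
    φ p ≤ φ (G.splitLeft x y d) ∧ φ p ≤ φ (G.splitRight x y d) := by
  induction Z generalizing p with
  | nil => exact absurd hd List.not_mem_nil
  | cons e Z ih =>
    obtain ⟨rfl, h2⟩ := hZ
    have h3 := hφ.le_of_tight (htight e (by simp))
    rcases List.mem_cons.1 hd with rfl | hd
    · exact ⟨le_rfl, h3⟩
    · have h4 := ih h2 (fun e' he' => htight e' (by simp [he'])) hd
      exact ⟨h3.trans h4.1, h3.trans h4.2⟩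

theorem length_nonneg (hφ : IsPotential c f x y v φ) (Z : List D) :
    0 ≤ length (fun d => c d - f d) Z := by
  refine List.sum_nonneg fun r hr => ?_
  obtain ⟨d, -, rfl⟩ := List.mem_map.1 hr
  exact sub_nonneg.2 (hφ.le_cap d)

/-- A dual path from `a` that is no longer than `v` only has darts with potential less than `v` at
their residual darts. -/
theorem lt_of_mem (hφ : IsPotential c f x y v φ) {W : List D} {q : SplitFace G.Face}
    (hW : G.IsSplitPath x y SplitFace.a W q) (hlen : length c W ≤ v) {d : D} (hd : d ∈ W)
    (hpos : 0 < c d - f d) : φ (G.splitRight x y d) < v := by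
  obtain ⟨P, Q, rfl⟩ := List.append_of_mem hd
  obtain ⟨p, h1, h2⟩ := isWalk_append_iff.1 hW
  obtain ⟨rfl, -⟩ := h2
  have h3 := hφ.length_sub h1
  have h4 := hφ.length_nonneg P
  have h5 := hφ.eq d
  have h6 : 0 ≤ length c Q := by
    refine List.sum_nonneg fun r hr => ?_
    obtain ⟨d, -, rfl⟩ := List.mem_map.1 hr
    exact hφ.nonneg d
  have h7 : length c (P ++ d :: Q) = length c P + (c d + length c Q) := by
    simp [length]
  have h8 := hφ.a
  linarith

theorem tight_of_length_le (hφ : IsPotential c f x y v φ) {Z : List D}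
    (hZ : G.IsSplitPath x y SplitFace.a Z SplitFace.b) (hlen : length c Z ≤ v) {d : D}
    (hd : d ∈ Z) : c d - f d ≤ 0 := by
  have h1 := hφ.length_sub hZ
  rw [hφ.a, hφ.b] at h1
  have h2 : c d - f d ≤ length (fun d => c d - f d) Z := by
    refine List.single_le_sum (fun r hr => ?_) _
      (List.mem_map_of_mem (f := fun d => c d - f d) hd)
    obtain ⟨d, -, rfl⟩ := List.mem_map.1 hr
    exact sub_nonneg.2 (hφ.le_cap d)
  linarith

theorem length_eq (hφ : IsPotential c f x y v φ) {Z : List D}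
    (hZ : G.IsSplitPath x y SplitFace.a Z SplitFace.b) (htight : ∀ d ∈ Z, c d - f d ≤ 0) :
    length c Z = v := by
  have h1 := hφ.length_sub hZ
  rw [hφ.a, hφ.b] at h1
  have h2 : length (fun d => c d - f d) Z ≤ 0 := by
    have h3 : (Z.map fun d => c d - f d).sum ≤ (Z.map fun _ => (0 : ℝ)).sum :=
      List.sum_le_sum htight
    simpa [length] using h3
  have := hφ.length_nonneg Z
  linarith

theorem le_length (hφ : IsPotential c f x y v φ) {Z : List D}
    (hZ : G.IsSplitPath x y SplitFace.a Z SplitFace.b) : v ≤ length c Z := by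
  have h1 := hφ.length_sub hZ
  rw [hφ.a, hφ.b] at h1
  have := hφ.length_nonneg Z
  linarith

/-- A simple tight dual path from `a` to `b` is a minimum cut. -/
theorem isMinCut (hφ : IsPotential c f x y v φ) {Z : List D}
    (hZ : IsSimplePath (G.splitLeft x y) (G.splitRight x y) SplitFace.a Z SplitFace.b)
    (htight : ∀ d ∈ Z, c d - f d ≤ 0) : G.IsMinCut c x y Z :=
  ⟨hZ, fun _ hP => (hφ.length_eq hZ.1 htight).trans_le (hφ.le_length hP)⟩

/-- The faces with potential less than `v` are reached through such faces. -/
theorem reflTransGen_lt (hφ : IsPotential c f x y v φ) {p : SplitFace G.Face}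
    (hp : Relation.ReflTransGen (fun p q => ∃ d, G.splitLeft x y d = p ∧
      G.splitRight x y d = q ∧ c d - f d ≤ 0) SplitFace.a p) (hlt : φ p < v) :
    0 < v ∧ Relation.ReflTransGen (fun p q => ∃ d, G.splitLeft x y d = p ∧
      G.splitRight x y d = q ∧ c d - f d ≤ 0 ∧ φ p < v ∧ φ q < v) SplitFace.a p := by
  induction hp with
  | refl => exact ⟨hφ.a ▸ hlt, Relation.ReflTransGen.refl⟩
  | tail _ h ih =>
    obtain ⟨d, rfl, rfl, hd⟩ := h
    have h1 := (hφ.le_of_tight hd).trans_lt hlt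
    obtain ⟨h2, h3⟩ := ih h1
    exact ⟨h2, h3.tail ⟨d, rfl, rfl, hd, h1, hlt⟩⟩

/-- If no clockwise cycle is residual and there is a tight dual path from `a` to `b`, then all
faces are reached from `a` by tight dual paths. -/
theorem reflTransGen (hx : G.left x = G.infFace)
    (hacyc : G.ClockwiseAcyclic fun d => c d - f d) {Z : List D}
    (hZ : G.IsSplitPath x y SplitFace.a Z SplitFace.b) (htight : ∀ d ∈ Z, c d - f d ≤ 0) (e : D) :
    Relation.ReflTransGen (fun p q => ∃ d, G.splitLeft x y d = p ∧
      G.splitRight x y d = q ∧ c d - f d ≤ 0) SplitFace.a (G.splitLeft x y e) := by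
  have hb := IsWalk.reflTransGen hZ htight
  have hinf : ∀ e, G.left e = G.infFace → Relation.ReflTransGen (fun p q => ∃ d,
      G.splitLeft x y d = p ∧ G.splitRight x y d = q ∧ c d - f d ≤ 0) SplitFace.a
      (G.splitLeft x y e) := by
    intro e he
    by_cases h : e ∈ G.boundaryArc x y
    · rw [G.splitLeft_of_mem h]
    · rwa [G.splitLeft_of_notMem he h]
  -- The infinite face stands for both a and b; both are reached, b by means of `Z`.
  suffices h : ∀ F, ∀ e, G.left e = F → Relation.ReflTransGen (fun p q => ∃ d,
      G.splitLeft x y d = p ∧ G.splitRight x y d = q ∧ c d - f d ≤ 0) SplitFace.a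
      (G.splitLeft x y e) from h _ e rfl
  intro F
  induction hacyc.reflTransGen F with
  | refl => exact hinf
  | tail _ h ih =>
    obtain ⟨d, rfl, rfl, hd⟩ := h
    intro e he
    by_cases hinf' : G.left e = G.infFace
    · exact hinf e hinf'
    · have h1 : G.splitLeft x y e = G.splitRight x y d := by
        rw [splitRight, G.splitLeft_of_left_ne hx hinf', G.splitLeft_of_left_ne hx] <;>
          rw [left_rev, ← he]
        exact hinf'
      rw [h1]
      exact (ih d rfl).tail ⟨d, rfl, rfl, hd⟩

/-- The vertices at faces with potential less than `v` are connected to `y` along such faces. -/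
theorem reflTransGen_tail (hφ : IsPotential c f x y v φ) (hx : G.left x = G.infFace)
    (hy : G.left y = G.infFace) (hne : x ≠ y) (hv : 0 < v) {p : SplitFace G.Face}
    (hp : Relation.ReflTransGen (fun p q => ∃ d, G.splitLeft x y d = p ∧
      G.splitRight x y d = q ∧ c d - f d ≤ 0 ∧ φ p < v ∧ φ q < v) SplitFace.a p) {e : D}
    (he : G.splitLeft x y e = p) :
    Relation.ReflTransGen (fun u w => ∃ d, G.tail d = u ∧ G.head d = w ∧
      (φ (G.splitLeft x y d) < v ∨ φ (G.splitRight x y d) < v)) (G.tail e) (G.tail y) := by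
  have ha : ∀ e, G.splitLeft x y e = SplitFace.a →
      Relation.ReflTransGen (fun u w => ∃ d, G.tail d = u ∧ G.head d = w ∧
        (φ (G.splitLeft x y d) < v ∨ φ (G.splitRight x y d) < v)) (G.tail e) (G.tail y) := by
    intro e he
    obtain ⟨n, -, hn, hmin⟩ := G.exists_first_pow (hx.trans hy.symm) hne
    obtain ⟨k, hk, rfl⟩ := (G.mem_boundaryArc_iff hn hmin).1 (G.splitLeft_eq_a_iff.1 he)
    have h1 : y = (G.faceNext ^ (n - k)) ((G.faceNext ^ k) x) := by
      rw [← Equiv.Perm.mul_apply, ← pow_add, Nat.sub_add_cancel hk.le, hn]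
    have h2 := G.reflTransGen_faceNext (d := (G.faceNext ^ k) x) (n := n - k)
      (Q := fun d => φ (G.splitLeft x y d) < v ∨ φ (G.splitRight x y d) < v) (fun l hl => by
        left
        rw [← Equiv.Perm.mul_apply, ← pow_add, G.splitLeft_of_mem, hφ.a]
        · exact hv
        · exact (G.mem_boundaryArc_iff hn hmin).2 ⟨l + k, by omega, rfl⟩)
    rwa [← h1] at h2
  induction hp generalizing e with
  | refl => exact ha e he
  | tail _ h ih =>
    obtain ⟨d, rfl, rfl, -, hlt, hlt'⟩ := h
    have h1 := Relation.ReflTransGen.head (r := fun u w => ∃ d, G.tail d = u ∧ G.head d = w ∧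
      (φ (G.splitLeft x y d) < v ∨ φ (G.splitRight x y d) < v))
      (⟨G.rev d, rfl, G.head_rev d, Or.inl hlt'⟩) (ih (e := d) rfl)
    by_cases hinf : G.left e = G.infFace
    · by_cases hmem : e ∈ G.boundaryArc x y
      · exact ha e (G.splitLeft_of_mem hmem)
      · rw [← he, G.splitLeft_of_notMem hinf hmem, hφ.b] at hlt'
        exact absurd hlt' (lt_irrefl _)
    · refine Relation.ReflTransGen.trans ?_ h1
      have h2 : G.left e = G.left (G.rev d) := by
        rw [G.splitLeft_of_left_ne hx hinf, eq_comm, splitRight,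
          G.splitLeft_eq_inner_iff hx] at he
        exact he.1.symm
      obtain ⟨n, hn⟩ : ∃ n : ℕ, (G.faceNext ^ n) e = G.rev d :=
        (G.left_eq_iff.1 h2).exists_nat_pow_eq
      rw [← hn]
      refine G.reflTransGen_faceNext (Q := fun d => φ (G.splitLeft x y d) < v ∨
        φ (G.splitRight x y d) < v) fun k _ => Or.inl ?_
      rw [G.splitLeft_of_left_ne hx (by simpa using hinf), left_faceNext_pow,
        ← G.splitLeft_of_left_ne (y := y) hx hinf, he]
      exact hlt'

/-- A residual simple path that has `a` on its left does not enter a face with potential less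
than `v`. -/
theorem not_lt_of_isSimplePath (hφ : IsPotential c f x y v φ) (hx : G.left x = G.infFace)
    {z w : D} (hz : G.left z = G.infFace) (hw : G.left w = G.infFace) (hzw : z ≠ w)
    (hsub : G.boundaryArc x y ⊆ G.boundaryArc z w) {R : List D}
    (hR : IsSimplePath G.tail G.head (G.tail z) R (G.tail w))
    (hres : IsResidual (fun d => c d - f d) R) {d : D} (hd : d ∈ R)
    (hreach : Relation.ReflTransGen (fun p q => ∃ d, G.splitLeft x y d = p ∧
      G.splitRight x y d = q ∧ c d - f d ≤ 0) SplitFace.a (G.splitRight x y d)) :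
    ¬ φ (G.splitRight x y d) < v := by
  intro hlt
  obtain ⟨ψ, ha, hb, hψ⟩ := (G.walkFlow_isFlowOfValue hR.1).exists_splitPotential hz hw hzw
  have hcongr : ∀ e, φ (G.splitLeft x y e) < v → G.splitLeft z w e = G.splitLeft x y e :=
    fun e he => G.splitLeft_congr hx hz hsub fun h => by
      rw [h, hφ.b] at he
      exact lt_irrefl _ he
  -- Tight darts are not on the residual path `R`, so ψ does not increase along them.
  have hle : ∀ p, Relation.ReflTransGen (fun p q => ∃ d, G.splitLeft x y d = p ∧
      G.splitRight x y d = q ∧ c d - f d ≤ 0 ∧ φ p < v ∧ φ q < v) SplitFace.a p → ψ p ≤ 0 := by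
    intro p hp
    induction hp with
    | refl => rw [ha]
    | tail _ h ih =>
      obtain ⟨e, rfl, rfl, he, h1, h2⟩ := h
      have h3 : ¬ 0 < G.walkFlow R e := fun h =>
        absurd (hres e (G.mem_of_walkFlow_pos h)) (not_lt.2 he)
      rw [hψ, splitRight, hcongr e h1, hcongr (G.rev e) h2] at h3
      rw [splitRight]
      linarith
  have h1 := hle _ (hφ.reflTransGen_lt hreach hlt).2
  have h2 := G.nonneg_of_isSimplePath hz hw hzw hR ha hb hψ d
  have h3 := G.walkFlow_pos hd (G.rev_notMem_of_isSimplePath hR hd)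
  rw [hψ, splitRight, hcongr (G.rev d) hlt] at h3
  rw [splitRight] at h1
  linarith

end IsPotential

/-! ### The sink side of a cut -/

section SinkSide

variable {x y : D} {C : List D}

/-- A vertex connected to both ends off the cut would give a walk from `x` to `y` avoiding `C`. -/
theorem notMem_sinkSide_of_reflTransGen (hx : G.left x = G.infFace) (hy : G.left y = G.infFace)
    (hne : x ≠ y) (hC : G.IsSplitPath x y SplitFace.a C SplitFace.b) {u : G.Vertex}
    (hu : Relation.ReflTransGen (fun u w => ∃ e, G.tail e = u ∧ G.head e = w ∧ e ∉ C ∧ G.rev e ∉ C)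
      (G.tail x) u) : ¬ G.sinkSide y C u := by
  intro hs
  have hsymm : Std.Symm fun u w => ∃ e, G.tail e = u ∧ G.head e = w ∧ e ∉ C ∧ G.rev e ∉ C := by
    constructor
    rintro _ _ ⟨e, rfl, rfl, h1, h2⟩
    exact ⟨G.rev e, rfl, by simp, h2, by rwa [G.rev_rev]⟩
  have h1 := hu.trans (Relation.ReflTransGen.stdSymm.symm _ _ hs)
  obtain ⟨P, hP, hPC⟩ := exists_isWalk_of_reflTransGen h1
  obtain ⟨d, hd, hd'⟩ := G.exists_mem_of_walk_of_splitPath hx hy hne hP hC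
  exact (hPC d hd').1 hd

/-- A dart with its head on the sink side that is not in the cut has its tail on the sink side. -/
theorem sinkSide_tail (hx : G.left x = G.infFace) (hy : G.left y = G.infFace) (hne : x ≠ y)
    (hC : IsSimplePath (G.splitLeft x y) (G.splitRight x y) SplitFace.a C SplitFace.b) {d : D}
    (hd : d ∉ C) (hh : G.sinkSide y C (G.head d)) : G.sinkSide y C (G.tail d) := by
  by_cases hrev : G.rev d ∈ C
  · exact absurd hh (notMem_sinkSide_of_reflTransGen hx hy hne hC.1
      (G.reflTransGen_tail_of_mem_cut hx hC hrev))
  · exact hh.tail ⟨G.rev d, rfl, by simp, hrev, by rwa [G.rev_rev]⟩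

end SinkSide

end PlaneGraph

/-! ### Tight dual paths left of the leftmost minimum cut -/

namespace PlaneGraph

variable {D : Type*} [Fintype D] {G : PlaneGraph D}

namespace IsPotential

variable {c f : D → ℝ} {x y : D} {v : ℝ} {φ : SplitFace G.Face → ℝ}

/-- The vertices from which the sink side is reached by a residual path are on the sink side. -/
theorem sinkSide_of_isWalk (hx : G.left x = G.infFace) (hy : G.left y = G.infFace) (hne : x ≠ y)
    {C : List D} (hC : IsSimplePath (G.splitLeft x y) (G.splitRight x y) SplitFace.a C SplitFace.b)
    (hCtight : ∀ d ∈ C, c d - f d ≤ 0) {u w : G.Vertex} {P : List D}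
    (hP : IsWalk G.tail G.head u P w) (hw : G.sinkSide y C w)
    (hres : ∀ d ∈ P, G.sinkSide y C (G.head d) → 0 < c d - f d) :
    IsResidual (fun d => c d - f d) P ∧ G.sinkSide y C u := by
  induction P generalizing u with
  | nil =>
    obtain rfl : u = w := hP
    exact ⟨fun d hd => absurd hd List.not_mem_nil, hw⟩
  | cons d P ih =>
    obtain ⟨rfl, h2⟩ := hP
    obtain ⟨h3, h4⟩ := ih h2 fun e he => hres e (List.mem_cons_of_mem _ he)
    have h5 := hres d List.mem_cons_self h4
    refine ⟨fun e he => ?_, sinkSide_tail hx hy hne hC (fun hd => ?_) h4⟩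
    · rcases List.mem_cons.1 he with rfl | he
      exacts [h5, h3 e he]
    · exact absurd h5 (not_lt.2 (hCtight d hd))

/-- If no residual path leads from `z` to `y`, and `z` is on the sink side of the leftmost minimum
cut, then there is a tight dual path separating `z` and `y` that does not separate `x` and `y`. -/
theorem exists_tight_path (hφ : IsPotential c f x y v φ) (hx : G.left x = G.infFace)
    (hy : G.left y = G.infFace) (hne : x ≠ y) {z : D} (hz : G.left z = G.infFace) (hzy : z ≠ y)
    {C : List D} (hC : G.IsLeftmostMinCut c x y C) (hCtight : ∀ d ∈ C, c d - f d ≤ 0)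
    (hzC : G.sinkSide y C (G.tail z))
    (hno : ∀ P, IsWalk G.tail G.head (G.tail z) P (G.tail y) →
      ¬ IsResidual (fun d => c d - f d) P) :
    ∃ Z, IsSimplePath (G.splitLeft z y) (G.splitRight z y) SplitFace.a Z SplitFace.b ∧
      (∀ d ∈ Z, c d - f d ≤ 0) ∧ ((∃ d ∈ Z, d ∈ G.boundaryArc z y ∧ d ∉ G.boundaryArc x y ∧
        G.IsSplitPath x y SplitFace.b Z SplitFace.b) ∨
      ∃ d ∈ Z, G.splitRight z y d = SplitFace.b ∧ G.rev d ∈ G.boundaryArc x y) := by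
  -- Duality for the tight darts in the closed region left of `C`. A walk to `y` avoiding them,
  -- followed backwards from `y`, never leaves the sink side and is residual.
  rcases G.exists_splitPath_or_exists_walk hz hy hzy
    (fun d => c d - f d ≤ 0 ∧ (G.sinkSide y C (G.tail d) ∨ G.sinkSide y C (G.head d))) with
    ⟨Z, hZ, hQ⟩ | ⟨P, hP, hQ⟩
  · refine ⟨Z, hZ, fun d hd => (hQ d hd).1, ?_⟩
    obtain _ | ⟨e, Z⟩ := Z
    · exact nomatch (show (SplitFace.a : SplitFace G.Face) = SplitFace.b from hZ.1)
    obtain ⟨e', he', hb, hw, heq⟩ := G.exists_isWalk_split (x' := x) (y' := y) hz hx hZ.1 hZ.2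
    have he : e ∈ G.boundaryArc z y := G.splitLeft_eq_a_iff.1 hZ.1.1
    by_cases h1 : G.rev e' ∈ G.boundaryArc x y
    · exact Or.inr ⟨e', he', hb, h1⟩
    have h2 : G.splitRight x y e' = SplitFace.b :=
      G.splitLeft_of_notMem (G.splitLeft_eq_b_iff.1 hb).1 h1
    rw [h2] at hw
    by_cases h3 : e ∈ G.boundaryArc x y
    · exfalso
      rw [G.splitLeft_of_mem h3] at hw
      -- Here `Z` would be a minimum cut left of `C`, hence `C` itself, although `C` does not
      -- separate `z` from `y`.
      have h4 := hC.2 _ (hφ.isMinCut ⟨hw, by rw [heq h2]; exact hZ.2⟩ fun d hd => (hQ d hd).1)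
        fun d hd => (hQ d hd).2
      exact notMem_sinkSide_of_reflTransGen hz hy hzy (h4 ▸ hZ.1) Relation.ReflTransGen.refl hzC
    · rw [G.splitLeft_of_notMem ((G.left_of_mem_boundaryArc he).trans hz) h3] at hw
      exact Or.inl ⟨e, List.mem_cons_self, he, h3, hw⟩
  · refine absurd (sinkSide_of_isWalk hx hy hne hC.1.1 hCtight hP Relation.ReflTransGen.refl
      fun d hd hh => ?_).1 (hno P hP)
    by_contra hle
    exact hQ d hd ⟨not_lt.1 hle, Or.inr hh⟩

end IsPotential

end PlaneGraph

end BoundaryFlow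

/-! ### The main theorem -/

open BoundaryFlow BoundaryFlow.PlaneGraph in
theorem mainTheorem5 {D : Type*} [Fintype D] (G : BoundaryFlow.PlaneGraph D) {m : ℕ}
    (K : BoundaryFlow.Terminals G m)
    (c : D → ℝ) (hc : ∀ d, 0 ≤ c d)
    (i j : Fin m) (c' : D → ℝ) (hc' : K.IterationStart c i j c')
    (f : D → ℝ) (hf : G.IsLeftmostMaxFlow c' (K.source i) (K.sink j) f)
    (C : List D) (hC : G.IsLeftmostMinCut c' (K.s i) (K.t j) C)
    (W : List D) (x : BoundaryFlow.SplitFace G.Face)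
    (hW : G.IsSplitPath (K.s i) (K.t j) BoundaryFlow.SplitFace.a W x)
    (hlength : BoundaryFlow.length c' W = G.inflow f (K.sink j))
    (hleft : G.IsLeftOf (K.t j) W C) :
    ∀ (k l : Fin m) (R : List D),
      BoundaryFlow.IsSimplePath G.tail G.head (K.source k) R (K.sink l) →
      BoundaryFlow.IsResidual (fun d => c' d - f d) R →
      ∀ d ∈ R, d ∉ W := by
  intro k l R hR hres d hdR hdW
  obtain ⟨hnonneg, hij, hclosed⟩ := hc'.not_isResidual
  have hclosed' := K.not_isResidual_sub hnonneg hclosed hf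
  have hx := K.left_s i
  have hy := K.left_t j
  have hne := K.s_ne_t i j
  obtain ⟨φ, ha, hb, hφ⟩ := (hf.flow.isFlowOfValue (K.source_ne_sink i j)).exists_splitPotential
    hx hy hne
  have pot : IsPotential c' f (K.s i) (K.t j) (G.inflow f (K.sink j)) φ :=
    ⟨ha, hb, hφ, hnonneg, hf.flow.le_cap⟩
  obtain ⟨P, hP, hPtight⟩ : ∃ P, G.IsSplitPath (K.s i) (K.t j) SplitFace.a P SplitFace.b ∧
      ∀ d ∈ P, c' d - f d ≤ 0 := by
    rcases G.exists_splitPath_or_exists_walk hx hy hne (fun d => c' d - f d ≤ 0) with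
      ⟨Z, hZ, hQ⟩ | ⟨Q, hQ, hQres⟩
    · exact ⟨Z, hZ.1, hQ⟩
    · exact absurd (fun d hd => not_le.1 (hQres d hd))
        (hf.not_isResidual (K.source_ne_sink i j) hQ)
  -- `C` is no longer than the tight path `P`, whose length is the flow value.
  have hCtight : ∀ d ∈ C, c' d - f d ≤ 0 := fun d hd =>
    pot.tight_of_length_le hC.1.1.1
      ((hC.1.2 P hP).trans_eq (pot.length_eq hP hPtight)) hd
  have hreach : ∀ e, _ := fun e => IsPotential.reflTransGen hx hf.leftmost hP hPtight e
  have hlt : φ (G.splitRight (K.s i) (K.t j) d) < G.inflow f (K.sink j) :=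
    pot.lt_of_mem hW hlength.le hdW (hres d hdR)
  have hkl : ¬ (l < k ∨ l < j ∨ (l = j ∧ i ≤ k)) := fun h => hclosed' k l h R hR.1 hres
  rcases lt_or_ge k i with hki | hik
  · exact pot.not_lt_of_isSimplePath hx (K.left_s k) (K.left_t l) (K.s_ne_t k l)
      (K.boundaryArc_subset hki.le hij (by omega)) hR hres hdR (hreach (G.rev d)) hlt
  obtain ⟨R₁, R₂, hR₁₂⟩ := List.append_of_mem hdR
  obtain ⟨u, hR₁, hud, hR₂⟩ : ∃ u, IsWalk G.tail G.head (K.source k) R₁ u ∧ G.tail d = u ∧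
      IsWalk G.tail G.head (G.head d) R₂ (K.sink l) := by
    have h1 := hR.1
    rw [hR₁₂] at h1
    obtain ⟨u, h2, h3⟩ := isWalk_append_iff.1 h1
    exact ⟨u, h2, h3⟩
  have hR₁res : ∀ e ∈ R₁, 0 < c' e - f e := fun e he => hres e (by simp [hR₁₂, he])
  have hkC : G.sinkSide (K.t j) C (G.tail (K.s k)) := by
    have h1 : G.sinkSide (K.t j) C (G.tail d) := by
      rcases hleft d hdW with h | h
      · exact h
      · exact sinkSide_tail hx hy hne hC.1.1
          (fun hd => absurd (hres d hdR) (not_lt.2 (hCtight d hd))) h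
    exact (IsPotential.sinkSide_of_isWalk hx hy hne hC.1.1 hCtight hR₁ (hud ▸ h1)
      fun e he _ => hR₁res e he).2
  have hik' : i < k := by
    refine lt_of_le_of_ne hik ?_
    rintro rfl
    exact notMem_sinkSide_of_reflTransGen hx hy hne hC.1.1.1 Relation.ReflTransGen.refl hkC
  have hz := K.left_s k
  have hzy := K.s_ne_t k j
  obtain ⟨Z, hZ, hZtight, hZ'⟩ := pot.exists_tight_path hx hy hne hz hzy hC hCtight hkC
    (hclosed' k j (Or.inr (Or.inr ⟨rfl, hik⟩)))
  rcases le_or_gt k j with hkj | hjk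
  · have hsub := K.boundaryArc_subset hik hkj le_rfl
    rcases hZ' with ⟨e, -, h1, h2, -⟩ | ⟨e, heZ, heb, he⟩
    · exact h2 (hsub h1)
    obtain _ | ⟨e₁, Z⟩ := Z
    · exact absurd heZ List.not_mem_nil
    obtain ⟨e', he'Z, he'b, hw, -⟩ := G.exists_isWalk_split (x' := K.s k) (y' := K.t l) hz hz
      hZ.1 hZ.2
    -- A simple path enters b only once.
    obtain rfl : e = e' := hZ.eq_of_tgt_eq heZ he'Z (heb.trans he'b.symm)
    rw [splitRight, G.splitLeft_eq_b_iff] at heb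
    have h3 : G.splitRight (K.s k) (K.t l) e = SplitFace.b :=
      G.splitLeft_of_notMem heb.1 fun h =>
        heb.2 (K.mem_boundaryArc_of_mem_of_mem hik hkj (by omega) he h)
    rw [h3, G.splitLeft_of_mem (K.boundaryArc_subset le_rfl hkj (by omega)
      (G.splitLeft_eq_a_iff.1 hZ.1.1))] at hw
    obtain ⟨e₂, h4, h5⟩ := G.exists_mem_of_walk_of_splitPath hz (K.left_t l) (K.s_ne_t k l)
      hR.1 hw
    exact absurd (hres e₂ h5) (not_lt.2 (hZtight e₂ h4))
  · have hsub := K.boundaryArc_subset_of_lt hij hjk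
    rcases hZ' with ⟨-, -, -, -, hw⟩ | ⟨e, -, heb, he⟩
    -- The continuation from the head of `d` to `t j` borders faces with φ below the flow value,
    -- whereas `Z` starts at b and stays at or above it.
    · obtain ⟨hv, hT⟩ := pot.reflTransGen_lt (hreach (G.rev d)) hlt
      obtain ⟨Q, hQ, hQlt⟩ := exists_isWalk_of_reflTransGen
        (pot.reflTransGen_tail hx hy hne hv hT (e := G.rev d) rfl)
      have hwalk : IsWalk G.tail G.head (G.tail (K.s k)) (R₁ ++ d :: Q) (G.tail (K.t j)) :=
        isWalk_append_iff.2 ⟨u, hR₁, hud, hQ⟩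
      obtain ⟨e, heZ, he⟩ := G.exists_mem_of_walk_of_splitPath hz hy hzy hwalk hZ.1
      have htight := hZtight e heZ
      rcases List.mem_append.1 he with he | he
      · exact absurd (hR₁res e he) (not_lt.2 htight)
      · rcases List.mem_cons.1 he with rfl | he
        · exact absurd (hres e hdR) (not_lt.2 htight)
        · obtain ⟨h1, h2⟩ := pot.le_of_isWalk hw hZtight heZ
          rw [hb] at h1 h2
          rcases hQlt e he with h | h <;> linarith
    · exact (G.splitLeft_eq_b_iff.1 heb).2 (hsub he)
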